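/- **Setting.** Consider a Markov decision process $\mathcal M$ with finite state space $\mathcal S$, finite action space $\mathcal A$ (transmit powers), nonempty sets $\mathcal A_s\subseteq\mathcal A$ of allowed actions and known transition probabilities $P(s'\mid s,a)$. Assume that $\mathcal M$ is ergodic: every deterministic stationary policy $\beta$ (a map $s\mapsto\beta(s)\in\mathcal A_s$) leads to an irreducible and aperiodic Markov chain, whose stationary distribution is denoted $\pi_\beta$. There are $M$ channels. The gain of a channel with parameter $\theta\in\Psi$ has density $g(\cdot;\theta)$ with respect to a measure $\nu$ on a measurable space $\mathcal X$. In each slot $t$ the agent observes the state $s_t$, chooses an action $a_t\in\mathcal A_{s_t}$ and a channel $j_t$, observes the gain $X_t$, which given the past has density $g(\cdot;\theta_{j_t})$, and receives the reward $r_t=f(a_t,X_t)$, where $f$ is known; given the past and $X_t$, the next state has law $P(\cdot\mid s_t,a_t)$. The law of the initial state is arbitrary but fixed. An allocation rule chooses $(a_t,j_t)$, possibly at random, as a function of $s_t$ and of the states, actions, channels and observed gains in the earlier slots. Write $$\mu(a;\theta)=\int f(a,x)\,g(x;\theta)\,d\nu(x),\qquad I(\theta,\theta')=\int \ln\frac{g(x;\theta)}{g(x;\theta')}\,g(x;\theta)\,d\nu(x)\in[0,\infty].$$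 For a parameter vector $\boldsymbol\theta=(\theta_1,\dots,\theta_M)\in\Psi^M$ put $\mu^*(a)=\max_j\mu(a;\theta_j)$, $\rho(\beta)=\sum_{s}\pi_\beta(s)\,\mu^*(\beta(s))$ and $\rho^*=\max_\beta\rho(\beta)$. The regret of a rule $\mathcal L$ is $\mathfrak R_{\mathcal L}(T)=T\rho^*-\mathbb E_{\boldsymbol\theta}\big[\sum_{t=0}^{T-1}r_t\big]$. A channel $j$ is *optimal* under $\boldsymbol\theta$ if there are a policy $\beta$ with $\rho(\beta)=\rho^*$ and a state $s$ with $\pi_\beta(s)>0$ such that $\mu(\beta(s);\theta_j)=\mu^*(\beta(s))$. Let $\mathcal O_{\boldsymbol\theta}$ be the set of optimal channels, and let $N_i(T)$ be the number of plays of channel $i$ in the first $T$ slots. **Assumptions.** - A1: for all $\theta\in\Psi$ and $a\in\mathcal A$, the mean $\mu(a;\theta)$ exists and is finite. - A2: for all $\theta\in\Psi$, $a\in\mathcal A$ and $\delta>0$ there is $\theta'\in\Psi$ with $\mu(a;\theta)<\mu(a;\theta')<\mu(a;\theta)+\delta$. - A3: $0<I(\theta,\theta')<\infty$ whenever $\mu(a;\theta)<\mu(a;\theta')$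 for some $a\in\mathcal A$. - A4: for all $\varepsilon>0$, $a\in\mathcal A$ and $\theta,\theta'\in\Psi$ with $\mu(a;\theta)<\mu(a;\theta')$ there is $\delta>0$ such that $|I(\theta,\theta')-I(\theta,\theta'')|<\varepsilon$ whenever $\mu(a;\theta')<\mu(a;\theta'')<\mu(a;\theta')+\delta$. **Theorem.** Assume A1–A4. Let $\mathcal L$ be an allocation rule such that, for every parameter vector in $\Psi^M$ and every $b>0$, $\mathfrak R_{\mathcal L}(T)=o(T^b)$ as $T\to\infty$. Then for every parameter vector $\boldsymbol\theta\in\Psi^M$ the set $\mathcal O_{\boldsymbol\theta}$ is nonempty, and for every channel $i\notin\mathcal O_{\boldsymbol\theta}$, $$\liminf_{T\to\infty}\ \mathbb E_{\boldsymbol\theta}\!\left[\frac{N_i(T)}{\ln T}\right]\ \ge\ \max_{j\in\mathcal O_{\boldsymbol\theta}}\frac{1}{I(\theta_i,\theta_j)}.$$ -/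

import Mathlib

open MeasureTheory ProbabilityTheory Filter Asymptotics
open scoped ENNReal

namespace MultiChannel

noncomputable section

/-! ### The Markov decision process -/

/-- A Markov decision process with state space `S` and action space `A` (the transmit powers):
the nonempty set `allowed s` of actions available in state `s`, and the law `trans (s, a)` of the
next state. Finiteness of `S` and `A` is imposed where it is used. -/
structure MDP (S A : Type*) [MeasurableSpace S] [MeasurableSpace A] where
  allowed : S → Set A
  allowed_nonempty : ∀ s, (allowed s).Nonempty
  trans : Kernel (S × A) S
  isMarkovKernel_trans : IsMarkovKernel trans

attribute [instance] MDP.isMarkovKernel_trans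

namespace MDP

variable {S A : Type*} [MeasurableSpace S] [MeasurableSpace A]

/-- Deterministic stationary policies. -/
def Policy (D : MDP S A) : Type _ := ∀ s : S, {a : A // a ∈ D.allowed s}

/-- The transition matrix of the Markov chain of states under the policy `β`. -/
def transMatrix (D : MDP S A) (β : D.Policy) : Matrix S S ℝ :=
  Matrix.of fun s s' => (D.trans (s, (β s : A))).real {s'}

/-- Every deterministic stationary policy leads to an irreducible and aperiodic Markov chain. -/
def IsErgodic [Fintype S] [DecidableEq S] (D : MDP S A) : Prop :=
  ∀ β : D.Policy,
    (∀ s s' : S, ∃ n : ℕ, 0 < (D.transMatrix β ^ n) s s') ∧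
    (∀ s : S, ∀ d : ℕ, (∀ n : ℕ, 0 < n → 0 < (D.transMatrix β ^ n) s s → d ∣ n) → d = 1)

/-- `π` is a stationary distribution of the chain of states under `β`. -/
def IsStationary [Fintype S] (D : MDP S A) (β : D.Policy) (π : S → ℝ) : Prop :=
  π ∈ stdSimplex ℝ S ∧ Matrix.vecMul π (D.transMatrix β) = π

open Classical in
/-- The stationary distribution `π_β` (it exists and is unique when the process is ergodic). -/
def stationaryDist [Fintype S] (D : MDP S A) (β : D.Policy) : S → ℝ :=
  if h : ∃ π, D.IsStationary β π then h.choose else 0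

end MDP

/-! ### The channel gains and the rates -/

/-- A family of densities `g (·; θ)`, `θ ∈ Ψ`, of a channel gain with respect to a measure `ν` on
the space `𝒳` of gains, and the rate `f a x` obtained with transmit power `a` and gain `x`. -/
structure GainModel (Ψ A 𝒳 : Type*) [MeasurableSpace 𝒳] where
  ν : Measure 𝒳
  g : Ψ → 𝒳 → ℝ
  measurable_g : ∀ θ, Measurable (g θ)
  g_nonneg : ∀ θ x, 0 ≤ g θ x
  lintegral_g : ∀ θ, ∫⁻ x, ENNReal.ofReal (g θ x) ∂ν = 1
  f : A → 𝒳 → ℝ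
  measurable_f : ∀ a, Measurable (f a)

namespace GainModel

variable {Ψ A 𝒳 : Type*} [MeasurableSpace 𝒳]

/-- The law of the gain with parameter `θ`. -/
def law (G : GainModel Ψ A 𝒳) (θ : Ψ) : Measure 𝒳 :=
  G.ν.withDensity fun x => ENNReal.ofReal (G.g θ x)

instance (G : GainModel Ψ A 𝒳) (θ : Ψ) : IsProbabilityMeasure (G.law θ) :=
  ⟨by rw [law, withDensity_apply _ MeasurableSet.univ, Measure.restrict_univ, G.lintegral_g]⟩

/-- The expected rate `μ(a; θ)`. -/
def mean (G : GainModel Ψ A 𝒳) (a : A) (θ : Ψ) : ℝ := ∫ x, G.f a x * G.g θ x ∂G.ν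

/-- The Kullback-Leibler distance `I(θ, θ') ∈ [0, ∞]`. -/
def I (G : GainModel Ψ A 𝒳) (θ θ' : Ψ) : ℝ≥0∞ := InformationTheory.klDiv (G.law θ) (G.law θ')

/-- A1: the means exist and are finite. -/
def A1 (G : GainModel Ψ A 𝒳) : Prop :=
  ∀ (θ : Ψ) (a : A), Integrable (fun x => G.f a x * G.g θ x) G.ν

/-- A2: denseness of the parameter set. -/
def A2 (G : GainModel Ψ A 𝒳) : Prop :=
  ∀ (θ : Ψ) (a : A) (δ : ℝ), 0 < δ → ∃ θ' : Ψ, G.mean a θ < G.mean a θ' ∧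
    G.mean a θ' < G.mean a θ + δ

/-- A3: positivity and finiteness of the distance. -/
def A3 (G : GainModel Ψ A 𝒳) : Prop :=
  ∀ θ θ' : Ψ, (∃ a : A, G.mean a θ < G.mean a θ') → 0 < G.I θ θ' ∧ G.I θ θ' < ∞

/-- A4: continuity of the distance in its second argument. -/
def A4 (G : GainModel Ψ A 𝒳) : Prop :=
  ∀ (ε : ℝ), 0 < ε → ∀ (a : A) (θ θ' : Ψ), G.mean a θ < G.mean a θ' →
    ∃ δ : ℝ, 0 < δ ∧ ∀ θ'' : Ψ, G.mean a θ' < G.mean a θ'' → G.mean a θ'' < G.mean a θ' + δ →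
      |(G.I θ θ').toReal - (G.I θ θ'').toReal| < ε

end GainModel

/-! ### The genie's benchmark and the optimal channels -/

section Optimal

variable {S A Ψ 𝒳 : Type*} [Fintype S] [MeasurableSpace S] [MeasurableSpace A]
  [MeasurableSpace 𝒳] {M : ℕ}

/-- The best expected rate `μ^*(a) = max_j μ(a; θ_j)` of the power level `a`. -/
def bestMean (G : GainModel Ψ A 𝒳) (θ : Fin M → Ψ) (a : A) : ℝ := ⨆ j : Fin M, G.mean a (θ j)

/-- The average reward of `β` when each power level is used on a best channel for it. -/
def avgReward (D : MDP S A) (G : GainModel Ψ A 𝒳) (θ : Fin M → Ψ) (β : D.Policy) : ℝ :=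
  ∑ s, D.stationaryDist β s * bestMean G θ (β s)

/-- The average reward `ρ^*` of the genie. -/
def optReward (D : MDP S A) (G : GainModel Ψ A 𝒳) (θ : Fin M → Ψ) : ℝ :=
  ⨆ β : D.Policy, avgReward D G θ β

/-- The set of optimal channels: those that are best for a power level which some optimal policy
uses with positive stationary probability. -/
def optimalChannels (D : MDP S A) (G : GainModel Ψ A 𝒳) (θ : Fin M → Ψ) : Set (Fin M) :=
  {j | ∃ β : D.Policy, (∀ β' : D.Policy, avgReward D G θ β' ≤ avgReward D G θ β) ∧
    ∃ s : S, 0 < D.stationaryDist β s ∧ ∀ k : Fin M, G.mean (β s) (θ k) ≤ G.mean (β s) (θ j)}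

end Optimal

/-! ### Allocation rules and the law of the controlled process -/

/-- The record of one slot: the state, the chosen power level and channel, and the gain of the
chosen channel, which is observed. -/
abbrev Slot (S A 𝒳 : Type*) (M : ℕ) : Type _ := S × ((A × Fin M) × 𝒳)

/-- An allocation rule. In slot `n` it sees the records of the slots `0, …, n - 1` and the current
state, and chooses, possibly at random, an allowed power level and a channel. -/
structure AllocationRule {S A : Type*} [MeasurableSpace S] [MeasurableSpace A]
    (D : MDP S A) (𝒳 : Type*) [MeasurableSpace 𝒳] (M : ℕ) where
  choose : (n : ℕ) → Kernel ((Fin n → Slot S A 𝒳 M) × S) (A × Fin M)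
  isMarkovKernel_choose : ∀ n, IsMarkovKernel (choose n)
  choose_allowed : ∀ n h s, choose n (h, s) {p | p.1 ∉ D.allowed s} = 0

attribute [instance] AllocationRule.isMarkovKernel_choose

section Dynamics

variable {S A Ψ 𝒳 : Type*} [MeasurableSpace S] [MeasurableSpace A] [MeasurableSpace 𝒳] {M : ℕ}

/-- The law of the gain of the chosen channel. -/
def gainKernel (G : GainModel Ψ A 𝒳) (θ : Fin M → Ψ) : Kernel (Fin M) 𝒳 where
  toFun j := G.law (θ j)
  measurable' := measurable_of_countable _

instance (G : GainModel Ψ A 𝒳) (θ : Fin M → Ψ) : IsMarkovKernel (gainKernel G θ) :=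
  ⟨fun j => inferInstanceAs (IsProbabilityMeasure (G.law (θ j)))⟩

/-- Given the past and the current state, the joint law of the choice of the rule and the gain. -/
def respond {D : MDP S A} (L : AllocationRule D 𝒳 M) (G : GainModel Ψ A 𝒳) (θ : Fin M → Ψ)
    (n : ℕ) : Kernel ((Fin n → Slot S A 𝒳 M) × S) ((A × Fin M) × 𝒳) :=
  L.choose n ⊗ₖ (gainKernel G θ).comap (fun p => p.2.2) (by fun_prop)

instance {D : MDP S A} (L : AllocationRule D 𝒳 M) (G : GainModel Ψ A 𝒳) (θ : Fin M → Ψ)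
    (n : ℕ) : IsMarkovKernel (respond L G θ n) := by
  unfold respond; infer_instance

/-- The law of the record of slot `0`, when the initial state has law `init`. -/
def firstSlot {D : MDP S A} (L : AllocationRule D 𝒳 M) (G : GainModel Ψ A 𝒳) (θ : Fin M → Ψ)
    (init : Measure S) : Measure (Slot S A 𝒳 M) :=
  init ⊗ₘ (respond L G θ 0).comap (fun s => (Fin.elim0, s)) (by fun_prop)

instance {D : MDP S A} (L : AllocationRule D 𝒳 M) (G : GainModel Ψ A 𝒳) (θ : Fin M → Ψ)
    (init : Measure S) [IsProbabilityMeasure init] :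
    IsProbabilityMeasure (firstSlot L G θ init) := by
  unfold firstSlot; infer_instance

/-- The law of the record of slot `n + 1`, given the records of the slots `0, …, n`. -/
def nextSlot {D : MDP S A} (L : AllocationRule D 𝒳 M) (G : GainModel Ψ A 𝒳) (θ : Fin M → Ψ)
    (n : ℕ) : Kernel (Finset.Iic n → Slot S A 𝒳 M) (Slot S A 𝒳 M) :=
  D.trans.comap
      (fun h => ((h ⟨n, Finset.mem_Iic.2 le_rfl⟩).1, (h ⟨n, Finset.mem_Iic.2 le_rfl⟩).2.1.1))
      (by fun_prop) ⊗ₖ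
    (respond L G θ (n + 1)).comap
      (fun p => (fun k : Fin (n + 1) => p.1 ⟨k, Finset.mem_Iic.2 (Nat.lt_succ_iff.1 k.2)⟩, p.2))
      (by fun_prop)

instance {D : MDP S A} (L : AllocationRule D 𝒳 M) (G : GainModel Ψ A 𝒳) (θ : Fin M → Ψ)
    (n : ℕ) : IsMarkovKernel (nextSlot L G θ n) := by
  unfold nextSlot; infer_instance

/-- The probability measure `P_θ` on infinite sequences of records. -/
def trajLaw {D : MDP S A} (L : AllocationRule D 𝒳 M) (G : GainModel Ψ A 𝒳) (θ : Fin M → Ψ)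
    (init : Measure S) [IsProbabilityMeasure init] : Measure (ℕ → Slot S A 𝒳 M) :=
  Kernel.trajMeasure (X := fun _ => Slot S A 𝒳 M) (firstSlot L G θ init)
    (fun n => nextSlot L G θ n)

/-- The reward `r_t = f(a_t, X_t)`. -/
def reward (G : GainModel Ψ A 𝒳) (t : ℕ) (ω : ℕ → Slot S A 𝒳 M) : ℝ :=
  G.f (ω t).2.1.1 (ω t).2.2

/-- The regret `T ρ^* - E_θ[∑_{t < T} r_t]`. -/
def regret [Fintype S] {D : MDP S A} (L : AllocationRule D 𝒳 M) (G : GainModel Ψ A 𝒳)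
    (θ : Fin M → Ψ) (init : Measure S) [IsProbabilityMeasure init] (T : ℕ) : ℝ :=
  T * optReward D G θ - ∫ ω, ∑ t ∈ Finset.range T, reward G t ω ∂(trajLaw L G θ init)

/-- The number `N_i(T)` of the slots `t < T` in which channel `i` is played. -/
def plays (i : Fin M) (T : ℕ) (ω : ℕ → Slot S A 𝒳 M) : ℕ :=
  ((Finset.range T).filter fun t => (ω t).2.1.2 = i).card

end Dynamics

end

end MultiChannel

namespace MultiChannel

noncomputable section

/-! ### Finite stochastic matrices -/

section Stochastic

variable {S : Type*} [Fintype S] [DecidableEq S] {P : Matrix S S ℝ}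

open Matrix

/-! The argument is a Lai–Robbins change of measure, with the Markov dynamics handled through the
average-reward optimality inequality. Fix a channel `i` that is not optimal and an optimal `j`,
witnessed by an optimal policy `β` and a state `s`. By A2 and A4 there is `ψ` with mean at `β s`
slightly above that of `θ j` and with `I (θ i) ψ` close to `I (θ i) (θ j)`. Let `θ'` be `θ` with
channel `i` replaced by `ψ`. Under `θ'` channel `i` is indispensable: making it a copy of `j`
instead brings the benchmark down to at most its value under `θ`, which is strictly smaller
(`optReward_update_le`, `optReward_lt_update`).

Small regret under `θ'` therefore forces linearly many plays of `i`. By `MDP.exists_bias`, a bias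
function makes the per-slot loss (`gap`) nonnegative, and its expected sum is at most the regret
plus a constant. The bias of the benchmark without `i` shows that each slot not playing `i` loses at
least the difference of the two benchmarks, up to a telescoping term and a martingale increment.
Markov's and Chebyshev's inequalities then give `P_θ'(N_i(T) < η T) = O(T ^ (b - 1))`
(`exists_measure_plays_lt_le`, `exists_measure_plays_lt_le_rpow`).

The laws of the first `T` slots under `θ` and `θ'` differ only in the gains of channel `i`, so their
divergence is at most `I (θ i) ψ * E_θ[N_i(T)]`. This is proved in the dual form `DVBound`, which
passes through composition products by testing bounded functions (`dvBound_histLaw`). Testing with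
`(1 - b) * log T` times the indicator of `{N_i(T) < η T}` yields `(1 - b) * log T * P_θ(N_i(T) < η
T) ≤ I (θ i) ψ * E_θ[N_i(T)] + O(1)` (`log_mul_measure_le`). The probability on the left is at least
`1 - E_θ[N_i(T)] / (η T)`, and solving this self-bounding inequality (`eventually_le_div_log`) gives
the logarithmic lower bound. -/

/-- A fixed function of an irreducible stochastic matrix is constant. -/
lemma eq_of_mulVec_eq_self (hP : P ∈ rowStochastic ℝ S)
    (hirr : ∀ s s' : S, ∃ n : ℕ, 0 < (P ^ n) s s') {h : S → ℝ} (hh : P *ᵥ h = h) (s s' : S) :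
    h s = h s' := by
  have hpow : ∀ n : ℕ, P ^ n *ᵥ h = h := by
    intro n
    induction n with
    | zero => simp
    | succ n ih => rw [pow_succ, ← Matrix.mulVec_mulVec, hh, ih]
  have : Nonempty S := ⟨s⟩
  -- Maximum principle: the value at a maximum is an average over all states reachable from it, so
  -- every one of them attains the maximum.
  obtain ⟨m, hm⟩ := Finite.exists_max h
  have key : ∀ y, h y = h m := by
    intro y
    obtain ⟨n, hn⟩ := hirr m y
    have hPn := pow_mem hP n
    have h1 : ∑ x, (P ^ n) m x * (h m - h x) = 0 := by
      have h2 : ∑ x, (P ^ n) m x * h x = h m := congrFun (hpow n) m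
      simp only [mul_sub, Finset.sum_sub_distrib, ← Finset.sum_mul,
        sum_row_of_mem_rowStochastic hPn, h2]
      ring
    have h3 := (Finset.sum_eq_zero_iff_of_nonneg (fun x _ => mul_nonneg
      (nonneg_of_mem_rowStochastic hPn) (sub_nonneg.2 (hm x)))).1 h1 y (Finset.mem_univ y)
    rcases mul_eq_zero.1 h3 with h4 | h4
    · exact absurd h4 hn.ne'
    · linarith
  rw [key s, key s']

/-- A stochastic matrix has a stationary distribution. -/
lemma exists_stationary [Nonempty S] (hP : P ∈ rowStochastic ℝ S) :
    ∃ π ∈ stdSimplex ℝ S, π ᵥ* P = π := by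
  -- The constant function is a right fixed vector, so there is also a left one `v`, of unknown
  -- sign. The triangle inequality gives `|v| ≤ |v| P` entrywise; both sides have the same total, so
  -- equality holds and `|v|` can be normalized.
  have hdet : (1 - P).det = 0 := by
    rw [← Matrix.exists_mulVec_eq_zero_iff]
    refine ⟨1, one_ne_zero, ?_⟩
    rw [Matrix.sub_mulVec, one_vecMul_of_mem_rowStochastic hP, Matrix.one_mulVec, sub_self]
  obtain ⟨v, hv0, hv⟩ := Matrix.exists_vecMul_eq_zero_iff.2 hdet
  rw [Matrix.vecMul_sub, Matrix.vecMul_one, sub_eq_zero] at hv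
  have hle : ∀ y, |v y| ≤ ∑ x, |v x| * P x y := by
    intro y
    have h1 : v y = ∑ x, v x * P x y := congrFun hv y
    calc |v y| = |∑ x, v x * P x y| := by rw [← h1]
      _ ≤ ∑ x, |v x * P x y| := Finset.abs_sum_le_sum_abs _ _
      _ = ∑ x, |v x| * P x y := Finset.sum_congr rfl fun x _ => by
        rw [abs_mul, abs_of_nonneg (nonneg_of_mem_rowStochastic hP)]
  have hsum : ∑ y, |v y| = ∑ y, ∑ x, |v x| * P x y := by
    rw [Finset.sum_comm]
    simp only [← Finset.mul_sum, sum_row_of_mem_rowStochastic hP, mul_one]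
  have heq : ∀ y, |v y| = ∑ x, |v x| * P x y := fun y =>
    (Finset.sum_eq_sum_iff_of_le fun y _ => hle y).1 hsum y (Finset.mem_univ y)
  have hpos : 0 < ∑ y, |v y| := by
    obtain ⟨y, hy⟩ := Function.ne_iff.1 hv0
    exact Finset.sum_pos' (fun y _ => abs_nonneg _) ⟨y, Finset.mem_univ y, abs_pos.2 hy⟩
  refine ⟨fun y => (∑ y, |v y|)⁻¹ * |v y|, ⟨fun y => by positivity, ?_⟩, ?_⟩
  · rw [← Finset.mul_sum, inv_mul_cancel₀ hpos.ne']
  · funext y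
    change ∑ x, (∑ y, |v y|)⁻¹ * |v x| * P x y = _
    rw [heq y, Finset.mul_sum]
    exact Finset.sum_congr rfl fun x _ => by ring

/-- A stationary distribution of an irreducible stochastic matrix is positive. -/
lemma stationary_pos (hP : P ∈ rowStochastic ℝ S)
    (hirr : ∀ s s' : S, ∃ n : ℕ, 0 < (P ^ n) s s') {π : S → ℝ} (hπ : π ∈ stdSimplex ℝ S)
    (hst : π ᵥ* P = π) (s : S) : 0 < π s := by
  have hpow : ∀ n : ℕ, π ᵥ* P ^ n = π := by
    intro n
    induction n with
    | zero => simp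
    | succ n ih => rw [pow_succ, ← Matrix.vecMul_vecMul, ih, hst]
  obtain ⟨s₀, -, h0⟩ := Finset.exists_ne_zero_of_sum_ne_zero (hπ.2.trans_ne one_ne_zero)
  obtain ⟨n, hn⟩ := hirr s₀ s
  have h1 : π s = ∑ x, π x * (P ^ n) x s := (congrFun (hpow n) s).symm
  rw [h1]
  exact Finset.sum_pos' (fun x _ => mul_nonneg (hπ.1 x)
    (nonneg_of_mem_rowStochastic (pow_mem hP n)))
    ⟨s₀, Finset.mem_univ _, mul_pos (lt_of_le_of_ne (hπ.1 s₀) h0.symm) hn⟩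

/-- The Poisson equation of an irreducible stochastic matrix. -/
lemma exists_poisson (hP : P ∈ rowStochastic ℝ S)
    (hirr : ∀ s s' : S, ∃ n : ℕ, 0 < (P ^ n) s s') {π : S → ℝ} (hπ : π ∈ stdSimplex ℝ S)
    (hst : π ᵥ* P = π) (r : S → ℝ) :
    ∃ h : S → ℝ, ∀ s, h s + ∑ x, π x * r x = r s + ∑ x, P s x * h x := by
  have hdot : ∀ h : S → ℝ, ∑ s, π s * ∑ x, P s x * h x = ∑ x, π x * h x := by
    intro h
    have : π ⬝ᵥ (P *ᵥ h) = π ⬝ᵥ h := by rw [Matrix.dotProduct_mulVec, hst]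
    exact this
  -- Adding the rank-one term `⟨π, h⟩` to `1 - P` removes the kernel of constants and makes the
  -- operator invertible. Pairing `T h = r` with `π` gives `⟨π, h⟩ = ⟨π, r⟩`, so the added term is
  -- exactly the average reward.
  let T : (S → ℝ) →ₗ[ℝ] (S → ℝ) :=
    { toFun := fun h s => h s - ∑ x, P s x * h x + ∑ x, π x * h x
      map_add' := fun a b => by
        funext s; simp only [Pi.add_apply, mul_add, Finset.sum_add_distrib]; ring
      map_smul' := fun c a => by
        funext s
        simp only [Pi.smul_apply, smul_eq_mul, mul_left_comm _ c, ← Finset.mul_sum,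
          RingHom.id_apply]
        ring }
  have hT : ∀ h s, T h s = h s - ∑ x, P s x * h x + ∑ x, π x * h x := fun _ _ => rfl
  have hTπ : ∀ h, ∑ s, π s * T h s = ∑ x, π x * h x := by
    intro h
    simp only [hT, mul_add, mul_sub, Finset.sum_add_distrib, Finset.sum_sub_distrib, hdot,
      ← Finset.sum_mul, hπ.2]
    ring
  have hinj : Function.Injective T := by
    rw [← LinearMap.ker_eq_bot, LinearMap.ker_eq_bot']
    intro h hh
    have h0 : ∑ x, π x * h x = 0 := by rw [← hTπ, hh]; simp
    have hfix : P *ᵥ h = h := by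
      funext s
      have := congrFun hh s
      rw [hT, h0] at this
      change ∑ x, P s x * h x = h s
      simp only [Pi.zero_apply] at this
      linarith
    funext s
    have : ∑ x, π x * h x = h s := by
      simp only [eq_of_mulVec_eq_self hP hirr hfix _ s, ← Finset.sum_mul, hπ.2, one_mul]
    simp [← this, h0]
  obtain ⟨h, hh⟩ := LinearMap.injective_iff_surjective.1 hinj r
  refine ⟨h, fun s => ?_⟩
  have h1 := congrFun hh s
  have h2 := hTπ h
  rw [hh] at h2
  rw [hT, ← h2] at h1
  linarith

end Stochastic

/-! ### The average-reward optimality inequality -/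

section Optimality

variable {S A : Type*} [Fintype S] [MeasurableSpace S]
  [MeasurableSingletonClass S] [MeasurableSpace A]

namespace MDP

/-- The expectation of `h` at the next state. -/
def expNext (D : MDP S A) (h : S → ℝ) (s : S) (a : A) : ℝ := ∫ x, h x ∂(D.trans (s, a))

lemma expNext_policy (D : MDP S A) (β : D.Policy) (h : S → ℝ) (s : S) :
    D.expNext h s (β s) = ∑ x, D.transMatrix β s x * h x := by
  rw [expNext, integral_fintype (Integrable.of_finite)]
  rfl

variable [DecidableEq S]

lemma transMatrix_mem (D : MDP S A) (β : D.Policy) :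
    D.transMatrix β ∈ Matrix.rowStochastic ℝ S := by
  rw [Matrix.mem_rowStochastic_iff_sum]
  refine ⟨fun s s' => measureReal_nonneg, fun s => ?_⟩
  have := D.expNext_policy β (fun _ => 1) s
  simpa [expNext] using this.symm

lemma isStationary_stationaryDist [Nonempty S] (D : MDP S A) (β : D.Policy) :
    D.IsStationary β (D.stationaryDist β) := by
  have h : ∃ π, D.IsStationary β π := exists_stationary (D.transMatrix_mem β)
  rw [stationaryDist, dif_pos h]
  exact h.choose_spec

lemma stationaryDist_pos [Nonempty S] (D : MDP S A) (hD : D.IsErgodic) (β : D.Policy) (s : S) :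
    0 < D.stationaryDist β s :=
  stationary_pos (D.transMatrix_mem β) (hD β).1 (D.isStationary_stationaryDist β).1
    (D.isStationary_stationaryDist β).2 s

instance [Finite A] (D : MDP S A) : Finite D.Policy := by
  unfold Policy; infer_instance

instance (D : MDP S A) : Nonempty D.Policy :=
  ⟨fun s => ⟨(D.allowed_nonempty s).some, (D.allowed_nonempty s).some_mem⟩⟩

/-- The average-reward optimality inequality: some bounded function compensates the differences
between the rewards of all the actions and the best average reward. -/
lemma exists_bias [Nonempty S] [Finite A] (D : MDP S A) (hD : D.IsErgodic) (r : A → ℝ) :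
    ∃ h : S → ℝ, ∀ s, ∀ a ∈ D.allowed s,
      r a + D.expNext h s a ≤ (⨆ β : D.Policy, ∑ s, D.stationaryDist β s * r (β s)) + h s := by
  obtain ⟨β, hβ⟩ := Finite.exists_max fun β : D.Policy => ∑ s, D.stationaryDist β s * r (β s)
  have hsup : (⨆ β : D.Policy, ∑ s, D.stationaryDist β s * r (β s)) =
      ∑ s, D.stationaryDist β s * r (β s) :=
    le_antisymm (ciSup_le hβ) (le_ciSup (Set.finite_range fun β : D.Policy =>
      ∑ s, D.stationaryDist β s * r (β s)).bddAbove β)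
  have hstat := D.isStationary_stationaryDist β
  obtain ⟨h, hh⟩ := exists_poisson (D.transMatrix_mem β) (hD β).1 hstat.1 hstat.2
    (fun s => r (β s))
  refine ⟨h, fun s a ha => ?_⟩
  rw [hsup]
  by_contra! hlt
  -- Policy improvement: if the inequality failed at `(s, a)`, deviating to `a` at the single state
  -- `s` would strictly increase the average reward, because the new stationary distribution charges
  -- `s`.
  let β' : D.Policy := Function.update β s ⟨a, ha⟩
  have hβ's : (β' s : A) = a := by
    rw [show β' s = ⟨a, ha⟩ from Function.update_self s _ β]
  have hβ'n : ∀ x, x ≠ s → β' x = β x := fun x hx =>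
    Function.update_of_ne hx _ β
  have hstat' := D.isStationary_stationaryDist β'
  set ρ := ∑ s, D.stationaryDist β s * r (β s) with hρ
  have hge : ∀ x, ρ + h x ≤ r (β' x) + D.expNext h x (β' x) := by
    intro x
    by_cases hx : x = s
    · subst hx; rw [hβ's]; exact hlt.le
    · rw [hβ'n x hx, expNext_policy, ← hh x]; linarith
  have hsum : ∑ x, D.stationaryDist β' x * (ρ + h x) <
      ∑ x, D.stationaryDist β' x * (r (β' x) + D.expNext h x (β' x)) := by
    refine Finset.sum_lt_sum (fun x _ => mul_le_mul_of_nonneg_left (hge x) (hstat'.1.1 x))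
      ⟨s, Finset.mem_univ s, mul_lt_mul_of_pos_left ?_ (D.stationaryDist_pos hD β' s)⟩
    rw [hβ's]; exact hlt
  have hdot : ∑ x, D.stationaryDist β' x * D.expNext h x (β' x) =
      ∑ x, D.stationaryDist β' x * h x := by
    simp only [expNext_policy]
    have : D.stationaryDist β' ⬝ᵥ (Matrix.mulVec (D.transMatrix β') h) =
        D.stationaryDist β' ⬝ᵥ h := by rw [Matrix.dotProduct_mulVec, hstat'.2]
    exact this
  simp only [mul_add, Finset.sum_add_distrib, ← Finset.sum_mul, hstat'.1.2, one_mul, hdot] at hsum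
  have := hβ β'
  linarith

end MDP

end Optimality

/-! ### The Donsker-Varadhan inequality -/

section DonskerVaradhan

variable {X Y : Type*} [MeasurableSpace X] [MeasurableSpace Y]

/-- The inequality of Donsker and Varadhan for the divergence bound `C`. -/
def DVBound (μ ν : Measure X) (C : ℝ) : Prop :=
  ∀ (φ : X → ℝ) (B : ℝ), Measurable φ → (∀ x, |φ x| ≤ B) →
    ∫ x, φ x ∂μ ≤ C + Real.log (∫ x, Real.exp (φ x) ∂ν)

lemma integrable_of_abs_le {μ : Measure X} [IsFiniteMeasure μ] {φ : X → ℝ} {B : ℝ}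
    (hφ : Measurable φ) (hB : ∀ x, |φ x| ≤ B) : Integrable φ μ :=
  Integrable.of_bound hφ.aestronglyMeasurable B (Eventually.of_forall hB)

lemma abs_integral_le_of_abs_le {μ : Measure X} [IsProbabilityMeasure μ] {φ : X → ℝ} {B : ℝ}
    (hB : ∀ x, |φ x| ≤ B) : |∫ x, φ x ∂μ| ≤ B := by
  simpa using norm_integral_le_of_norm_le_const (μ := μ) (f := φ) (Eventually.of_forall hB)

lemma exp_le_of_abs_le {x B : ℝ} (h : |x| ≤ B) : |Real.exp x| ≤ Real.exp B := by
  rw [Real.abs_exp]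
  exact Real.exp_le_exp.2 ((le_abs_self x).trans h)

/-- The bound makes the logarithmic exponential moment of a fibre an admissible test function on the
base in `DVBound.compProd`. -/
lemma abs_log_integral_exp_le {ν : Measure X} [IsProbabilityMeasure ν] {φ : X → ℝ} {B : ℝ}
    (hφ : Measurable φ) (hB : ∀ x, |φ x| ≤ B) :
    |Real.log (∫ x, Real.exp (φ x) ∂ν)| ≤ B ∧ 0 < ∫ x, Real.exp (φ x) ∂ν := by
  have hint : Integrable (fun x => Real.exp (φ x)) ν :=
    integrable_of_abs_le hφ.exp fun x => exp_le_of_abs_le (hB x)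
  have h1 : Real.exp (-B) ≤ ∫ x, Real.exp (φ x) ∂ν := by
    have := integral_mono (μ := ν) (integrable_const (Real.exp (-B))) hint
      fun x => Real.exp_le_exp.2 (abs_le.1 (hB x)).1
    simpa using this
  have h2 : ∫ x, Real.exp (φ x) ∂ν ≤ Real.exp B := by
    have := integral_mono (μ := ν) hint (integrable_const (Real.exp B))
      fun x => Real.exp_le_exp.2 (abs_le.1 (hB x)).2
    simpa using this
  have h0 : 0 < ∫ x, Real.exp (φ x) ∂ν := (Real.exp_pos _).trans_le h1
  exact ⟨abs_le.2 ⟨(Real.le_log_iff_exp_le h0).2 h1, (Real.log_le_iff_le_exp h0).2 h2⟩, h0⟩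

/-- Nonnegativity of the divergence of `μ` from the exponentially tilted measure `ν.tilted φ`,
expanded, is the claimed inequality. -/
lemma dvBound_of_klDiv_ne_top {μ ν : Measure X} [IsProbabilityMeasure μ] [IsProbabilityMeasure ν]
    (h : InformationTheory.klDiv μ ν ≠ ∞) :
    DVBound μ ν (InformationTheory.klDiv μ ν).toReal := by
  intro φ B hφ hB
  obtain ⟨hac, hint⟩ := InformationTheory.klDiv_ne_top_iff.1 h
  have hμ : Integrable φ μ := integrable_of_abs_le hφ hB
  have hν : Integrable (fun x => Real.exp (φ x)) ν :=
    integrable_of_abs_le hφ.exp fun x => exp_le_of_abs_le (hB x)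
  have := isProbabilityMeasure_tilted hν
  have hac' : μ ≪ ν.tilted φ := hac.trans (absolutelyContinuous_tilted hν)
  have h1 := integral_llr_tilted_right hac hμ hν hint
  have h2 := InformationTheory.integral_llr_add_sub_measure_univ_nonneg hac'
    (integrable_llr_tilted_right hac hμ hint hν)
  rw [InformationTheory.toReal_klDiv_of_measure_eq hac (by simp)]
  simp only [probReal_univ] at h2
  linarith

lemma dvBound_self (μ : Measure X) [IsProbabilityMeasure μ] : DVBound μ μ 0 := by
  simpa using dvBound_of_klDiv_ne_top (μ := μ) (ν := μ) (by simp)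

/-- Chain rule in dual form: bound each fibre integral first, then test the base with the logarithm
of the fibre exponential moment, whose exponential integrates back to the joint moment. -/
lemma DVBound.compProd {μ ν : Measure X} [IsProbabilityMeasure μ] [IsProbabilityMeasure ν]
    {κ η : Kernel X Y} [IsMarkovKernel κ] [IsMarkovKernel η] {C : ℝ} (h : DVBound μ ν C)
    {d : X → ℝ} (hd : Integrable d μ) (hκ : ∀ x, DVBound (κ x) (η x) (d x)) :
    DVBound (μ ⊗ₘ κ) (ν ⊗ₘ η) (C + ∫ x, d x ∂μ) := by
  intro φ B hφ hB
  have hexp : Measurable fun p => Real.exp (φ p) := hφ.exp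
  have hψm : Measurable fun x => Real.log (∫ y, Real.exp (φ (x, y)) ∂(η x)) :=
    (hexp.stronglyMeasurable.integral_kernel_prod_right' (κ := η)).measurable.log
  have hsec : ∀ x, Measurable fun y => φ (x, y) := fun x => hφ.comp measurable_prodMk_left
  have hψB : ∀ x, |Real.log (∫ y, Real.exp (φ (x, y)) ∂(η x))| ≤ B := fun x =>
    (abs_log_integral_exp_le (hsec x) fun y => hB (x, y)).1
  have hφi : Integrable (fun x => ∫ y, φ (x, y) ∂(κ x)) μ :=
    integrable_of_abs_le
      (hφ.stronglyMeasurable.integral_kernel_prod_right' (κ := κ)).measurable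
      fun x => abs_integral_le_of_abs_le fun y => hB (x, y)
  have hψi := integrable_of_abs_le (μ := μ) hψm hψB
  rw [Measure.integral_compProd (integrable_of_abs_le hφ hB),
    Measure.integral_compProd (integrable_of_abs_le hexp fun p => exp_le_of_abs_le (hB p))]
  calc ∫ x, ∫ y, φ (x, y) ∂(κ x) ∂μ
      ≤ ∫ x, (d x + Real.log (∫ y, Real.exp (φ (x, y)) ∂(η x))) ∂μ :=
        integral_mono hφi (hd.add hψi)
          fun x => hκ x _ B (hsec x) fun y => hB (x, y)
    _ = ∫ x, d x ∂μ + ∫ x, Real.log (∫ y, Real.exp (φ (x, y)) ∂(η x)) ∂μ :=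
        integral_add hd hψi
    _ ≤ ∫ x, d x ∂μ +
        (C + Real.log (∫ x, Real.exp (Real.log (∫ y, Real.exp (φ (x, y)) ∂(η x))) ∂ν)) :=
        add_le_add_right (h _ B hψm hψB) _
    _ = C + ∫ x, d x ∂μ + Real.log (∫ x, ∫ y, Real.exp (φ (x, y)) ∂(η x) ∂ν) := by
        have : ∀ x, Real.exp (Real.log (∫ y, Real.exp (φ (x, y)) ∂(η x))) =
            ∫ y, Real.exp (φ (x, y)) ∂(η x) := fun x =>
          Real.exp_log (abs_log_integral_exp_le (hsec x) fun y => hB (x, y)).2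
        simp only [this]
        ring

lemma DVBound.map {μ ν : Measure X} {C : ℝ} (h : DVBound μ ν C) {f : X → Y} (hf : Measurable f) :
    DVBound (μ.map f) (ν.map f) C := by
  intro φ B hφ hB
  rw [integral_map hf.aemeasurable hφ.aestronglyMeasurable,
    integral_map hf.aemeasurable hφ.exp.aestronglyMeasurable]
  exact h _ B (hφ.comp hf) fun x => hB (f x)

end DonskerVaradhan

/-! ### The finite-horizon laws of the controlled process -/

section History

variable {S A Ψ 𝒳 : Type*} [MeasurableSpace S] [MeasurableSpace A] [MeasurableSpace 𝒳] {M : ℕ}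

/-- The records of the slots before `n`. -/
def hist (n : ℕ) (ω : ℕ → Slot S A 𝒳 M) : Fin n → Slot S A 𝒳 M := fun k => ω k

@[fun_prop]
lemma measurable_hist (n : ℕ) :
    Measurable (hist n : (ℕ → Slot S A 𝒳 M) → (Fin n → Slot S A 𝒳 M)) := by
  unfold hist; fun_prop

/-- The law of the state of slot `n`, given the records of the earlier slots. -/
def stateKernel (D : MDP S A) (𝒳 : Type*) [MeasurableSpace 𝒳] (M : ℕ) (init : Measure S) :
    (n : ℕ) → Kernel (Fin n → Slot S A 𝒳 M) S
  | 0 => Kernel.const _ init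
  | n + 1 => D.trans.comap (fun h => ((h (Fin.last n)).1, (h (Fin.last n)).2.1.1)) (by fun_prop)

instance (D : MDP S A) (init : Measure S) [IsProbabilityMeasure init] (n : ℕ) :
    IsMarkovKernel (stateKernel D 𝒳 M init n) := by
  cases n <;> unfold stateKernel <;> infer_instance

variable {D : MDP S A} (L : AllocationRule D 𝒳 M) (G : GainModel Ψ A 𝒳) (θ : Fin M → Ψ)
  (init : Measure S) [IsProbabilityMeasure init]

instance : IsProbabilityMeasure (trajLaw L G θ init) := by
  unfold trajLaw; infer_instance

/-- The law of the records of the slots before `n`. -/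
def histLaw (n : ℕ) : Measure (Fin n → Slot S A 𝒳 M) := (trajLaw L G θ init).map (hist n)

instance (n : ℕ) : IsProbabilityMeasure (histLaw L G θ init n) :=
  Measure.isProbabilityMeasure_map (measurable_hist n).aemeasurable

/-- Used to pass between histories indexed by `Finset.Iic n`, as in the trajectory measure, and by
`Fin (n + 1)`, as in the allocation rule. -/
lemma map_compProd_eq {X Y Z : Type*} [MeasurableSpace X] [MeasurableSpace Y] [MeasurableSpace Z]
    (μ : Measure X) [IsProbabilityMeasure μ] {f : X → Y} (hf : Measurable f) (κ : Kernel Y Z)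
    [IsMarkovKernel κ] :
    (μ.map f) ⊗ₘ κ = (μ ⊗ₘ κ.comap f hf).map (Prod.map f id) := by
  have := Measure.isProbabilityMeasure_map (μ := μ) hf.aemeasurable
  ext s hs
  rw [Measure.compProd_apply hs, Measure.map_apply (by fun_prop) hs,
    Measure.compProd_apply (hs.preimage (by fun_prop)),
    lintegral_map (Kernel.measurable_kernel_prodMk_left hs) hf]
  rfl

lemma nextSlot_eq (n : ℕ) :
    nextSlot L G θ n = (stateKernel D 𝒳 M init (n + 1) ⊗ₖ respond L G θ (n + 1)).comap
      (fun (h : Finset.Iic n → Slot S A 𝒳 M) (k : Fin (n + 1)) =>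
        h ⟨k, Finset.mem_Iic.2 (Nat.lt_succ_iff.1 k.2)⟩) (by fun_prop) := by
  ext h s hs
  rw [nextSlot, Kernel.comap_apply (stateKernel D 𝒳 M init (n + 1) ⊗ₖ respond L G θ (n + 1)),
    Kernel.compProd_apply hs, Kernel.compProd_apply hs]
  rfl

lemma map_zero_trajLaw :
    (trajLaw L G θ init).map (fun ω => ω 0) = firstSlot L G θ init := by
  have h1 : (fun ω : ℕ → Slot S A 𝒳 M => ω 0) =
      (fun h : Finset.Iic 0 → Slot S A 𝒳 M => h ⟨0, Finset.mem_Iic.2 le_rfl⟩) ∘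
        Preorder.frestrictLe 0 := rfl
  rw [h1, ← Measure.map_map (by fun_prop) (by fun_prop), trajLaw, Kernel.trajMeasure,
    Measure.map_comp _ _ (by fun_prop), Kernel.traj_map_frestrictLe, Kernel.partialTraj_self,
    Measure.id_comp, Measure.map_map (by fun_prop) (by fun_prop)]
  exact Measure.map_id

lemma histLaw_zero :
    histLaw L G θ init 0 = Measure.dirac (Fin.elim0 : Fin 0 → Slot S A 𝒳 M) := by
  have : (hist 0 : (ℕ → Slot S A 𝒳 M) → _) = fun _ => Fin.elim0 := by
    funext ω; exact Subsingleton.elim _ _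
  rw [histLaw, this, Measure.map_const]
  simp

/-- The law of the records up to slot `n`. -/
lemma map_hist_slot (n : ℕ) :
    (trajLaw L G θ init).map (fun ω => (hist n ω, ω n)) =
      histLaw L G θ init n ⊗ₘ (stateKernel D 𝒳 M init n ⊗ₖ respond L G θ n) := by
  cases n with
  | zero =>
    have h2 : (fun ω : ℕ → Slot S A 𝒳 M => (hist 0 ω, ω 0)) =
        Prod.mk (Fin.elim0 : Fin 0 → Slot S A 𝒳 M) ∘ fun ω => ω 0 := by
      funext ω; exact Prod.ext (Subsingleton.elim _ _) rfl
    rw [histLaw_zero, h2, ← Measure.map_map (by fun_prop) (by fun_prop), map_zero_trajLaw]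
    ext s hs
    rw [Measure.dirac_compProd_apply hs, Measure.map_apply (by fun_prop) hs,
      Kernel.compProd_apply_eq_compProd_sectR]
    rfl
  | succ n =>
    have h1 := Kernel.map_frestrictLe_trajMeasure_compProd_eq_map_trajMeasure
      (X := fun _ => Slot S A 𝒳 M) (μ₀ := firstSlot L G θ init)
      (κ := fun n => nextSlot L G θ n) (a := n)
    set e : (Finset.Iic n → Slot S A 𝒳 M) → (Fin (n + 1) → Slot S A 𝒳 M) :=
      fun h k => h ⟨k, Finset.mem_Iic.2 (Nat.lt_succ_iff.1 k.2)⟩ with he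
    have hem : Measurable e := by fun_prop
    have h2 : histLaw L G θ init (n + 1) =
        ((trajLaw L G θ init).map (Preorder.frestrictLe n)).map e := by
      rw [Measure.map_map hem (by fun_prop)]; rfl
    have := Measure.isProbabilityMeasure_map (μ := trajLaw L G θ init)
      (f := Preorder.frestrictLe (π := fun _ => Slot S A 𝒳 M) n) (by fun_prop)
    rw [h2, map_compProd_eq _ hem, ← nextSlot_eq]
    change _ = ((Kernel.trajMeasure (X := fun _ => Slot S A 𝒳 M) (firstSlot L G θ init)
      (fun n => nextSlot L G θ n)).map (Preorder.frestrictLe n) ⊗ₘ nextSlot L G θ n).map _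
    rw [h1, Measure.map_map (by fun_prop) (by fun_prop)]
    rfl

/-- The records before slot `n`, and the state, the choice and the gain of slot `n`. -/
def slotView (n : ℕ) (ω : ℕ → Slot S A 𝒳 M) :
    (((Fin n → Slot S A 𝒳 M) × S) × (A × Fin M)) × 𝒳 :=
  (((hist n ω, (ω n).1), (ω n).2.1), (ω n).2.2)

@[fun_prop]
lemma measurable_slotView (n : ℕ) :
    Measurable (slotView n : (ℕ → Slot S A 𝒳 M) → _) := by
  unfold slotView; fun_prop

/-- The law of the records before slot `n` and of the state and the choice of slot `n`. -/
def choiceLaw (n : ℕ) : Measure (((Fin n → Slot S A 𝒳 M) × S) × (A × Fin M)) :=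
  (histLaw L G θ init n ⊗ₘ stateKernel D 𝒳 M init n) ⊗ₘ L.choose n

instance (n : ℕ) : IsProbabilityMeasure (choiceLaw L G θ init n) := by
  unfold choiceLaw; infer_instance

/-- Isolates the gain as the last coordinate. Given the history, the state and the choice, it is the
only ingredient of a slot whose conditional law depends on the parameters. -/
lemma map_slotView (n : ℕ) :
    (trajLaw L G θ init).map (slotView n) = choiceLaw L G θ init n ⊗ₘ
      (gainKernel G θ).comap (fun p => p.2.2) (by fun_prop) := by
  have h : (slotView n : (ℕ → Slot S A 𝒳 M) → _) = MeasurableEquiv.prodAssoc.symm ∘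
      MeasurableEquiv.prodAssoc.symm ∘ fun ω => (hist n ω, ω n) := rfl
  rw [h, ← Measure.map_map (by fun_prop) (by fun_prop),
    ← Measure.map_map (by fun_prop) (by fun_prop), map_hist_slot, Measure.compProd_assoc,
    respond, Measure.compProd_assoc, choiceLaw]

lemma map_choice (n : ℕ) :
    (trajLaw L G θ init).map (fun ω => ((hist n ω, (ω n).1), (ω n).2.1)) =
      choiceLaw L G θ init n := by
  have h : (fun ω : ℕ → Slot S A 𝒳 M => ((hist n ω, (ω n).1), (ω n).2.1)) =
      Prod.fst ∘ slotView n := rfl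
  rw [h, ← Measure.map_map (by fun_prop) (by fun_prop), map_slotView]
  exact Measure.fst_compProd _ _

lemma map_hist_state (n : ℕ) :
    (trajLaw L G θ init).map (fun ω => (hist n ω, (ω n).1)) =
      histLaw L G θ init n ⊗ₘ stateKernel D 𝒳 M init n := by
  have h : (fun ω : ℕ → Slot S A 𝒳 M => (hist n ω, (ω n).1)) =
      Prod.fst ∘ fun ω => ((hist n ω, (ω n).1), (ω n).2.1) := rfl
  rw [h, ← Measure.map_map (by fun_prop) (by fun_prop), map_choice]
  exact Measure.fst_compProd _ _

/-- Appending the record of a slot. -/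
def appendSlot (n : ℕ) (p : (((Fin n → Slot S A 𝒳 M) × S) × (A × Fin M)) × 𝒳) :
    Fin (n + 1) → Slot S A 𝒳 M :=
  fun k => if h : (k : ℕ) < n then p.1.1.1 ⟨k, h⟩ else (p.1.1.2, (p.1.2, p.2))

lemma measurable_appendSlot (n : ℕ) :
    Measurable (appendSlot n :
      (((Fin n → Slot S A 𝒳 M) × S) × (A × Fin M)) × 𝒳 → _) := by
  refine measurable_pi_lambda _ fun k => ?_
  unfold appendSlot
  split_ifs <;> fun_prop

lemma histLaw_succ (n : ℕ) :
    histLaw L G θ init (n + 1) = (choiceLaw L G θ init n ⊗ₘ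
      (gainKernel G θ).comap (fun p => p.2.2) (by fun_prop)).map (appendSlot n) := by
  rw [← map_slotView, Measure.map_map (measurable_appendSlot n) (by fun_prop), histLaw]
  congr 1
  funext ω k
  simp only [hist, Function.comp_apply, appendSlot, slotView]
  split_ifs with h
  · rfl
  · rw [show (k : ℕ) = n by omega]

end History

/-! ### Change of measure -/

section Plays

variable {S A 𝒳 : Type*} {M : ℕ}

lemma plays_eq_sum (i : Fin M) (T : ℕ) (ω : ℕ → Slot S A 𝒳 M) :
    (plays i T ω : ℝ) = ∑ t ∈ Finset.range T, if (ω t).2.1.2 = i then 1 else 0 := by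
  rw [plays, Finset.sum_boole]

lemma plays_le (i : Fin M) (T : ℕ) (ω : ℕ → Slot S A 𝒳 M) : plays i T ω ≤ T :=
  (Finset.card_filter_le _ _).trans (Finset.card_range T).le

lemma abs_ite_zero_le (p : Prop) [Decidable p] (c : ℝ) : |if p then c else 0| ≤ |c| := by
  split_ifs <;> simp

end Plays

section ChangeOfMeasure

variable {S A Ψ 𝒳 : Type*} [MeasurableSpace S] [MeasurableSpace A] [MeasurableSpace 𝒳] {M : ℕ}
  {D : MDP S A} (L : AllocationRule D 𝒳 M) (G : GainModel Ψ A 𝒳)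
  (init : Measure S) [IsProbabilityMeasure init]

lemma measurable_played (i : Fin M) (t : ℕ) (c : ℝ) :
    Measurable fun ω : ℕ → Slot S A 𝒳 M => if (ω t).2.1.2 = i then c else 0 :=
  (measurable_of_countable fun k : Fin M => if k = i then c else 0).comp (by fun_prop)

lemma measurable_plays (i : Fin M) (T : ℕ) :
    Measurable fun ω : ℕ → Slot S A 𝒳 M => (plays i T ω : ℝ) := by
  simp only [plays_eq_sum]
  exact Finset.measurable_sum _ fun t _ => measurable_played i t 1

lemma integrable_plays (θ : Fin M → Ψ) (i : Fin M) (T : ℕ) :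
    Integrable (fun ω => (plays i T ω : ℝ)) (trajLaw L G θ init) :=
  integrable_of_abs_le (B := T) (measurable_plays i T) fun ω => by
    rw [abs_of_nonneg (Nat.cast_nonneg _)]
    exact_mod_cast plays_le i T ω

/-- The divergence bound of the laws of the records under two parameter vectors that differ in the
channel `i` only. -/
lemma dvBound_histLaw {θ θ' : Fin M → Ψ} {i : Fin M} (hθ : ∀ k, k ≠ i → θ' k = θ k)
    (hI : G.I (θ i) (θ' i) ≠ ∞) (T : ℕ) :
    DVBound (histLaw L G θ init T) (histLaw L G θ' init T)
      ((G.I (θ i) (θ' i)).toReal * ∫ ω, (plays i T ω : ℝ) ∂(trajLaw L G θ init)) := by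
  set I := (G.I (θ i) (θ' i)).toReal with hIdef
  induction T with
  | zero =>
    simp only [histLaw_zero]
    simpa [plays] using dvBound_self (Measure.dirac (Fin.elim0 : Fin 0 → Slot S A 𝒳 M))
  | succ n ih =>
    -- State and choice have the same conditional laws under both parameter vectors and cost
    -- nothing; the gain costs `I` exactly when channel `i` is played.
    have hstate := ih.compProd (integrable_zero _ _ _)
      (fun h => dvBound_self (stateKernel D 𝒳 M init n h))
    have hchoice := hstate.compProd (integrable_zero _ _ _) (fun h => dvBound_self (L.choose n h))
    have hdm : Measurable fun p : (((Fin n → Slot S A 𝒳 M) × S) × (A × Fin M)) =>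
        if p.2.2 = i then I else 0 :=
      (measurable_of_countable fun k : Fin M => if k = i then I else 0).comp (by fun_prop)
    have hgain := hchoice.compProd (κ := (gainKernel G θ).comap (fun p => p.2.2) (by fun_prop))
      (η := (gainKernel G θ').comap (fun p => p.2.2) (by fun_prop))
      (integrable_of_abs_le hdm fun p => abs_ite_zero_le _ I) (fun p => by
        change DVBound (G.law (θ p.2.2)) (G.law (θ' p.2.2)) _
        split_ifs with h
        · rw [h]; exact dvBound_of_klDiv_ne_top hI
        · rw [hθ _ h]; exact dvBound_self _)
    have hfin := hgain.map (measurable_appendSlot n)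
    rw [histLaw_succ, histLaw_succ]
    have hC : ∫ ω, (plays i (n + 1) ω : ℝ) ∂(trajLaw L G θ init) =
        ∫ ω, (plays i n ω : ℝ) ∂(trajLaw L G θ init) +
          ∫ ω, (if (ω n).2.1.2 = i then 1 else 0 : ℝ) ∂(trajLaw L G θ init) := by
      rw [← integral_add (integrable_plays L G init θ i n)
        (integrable_of_abs_le (measurable_played i n 1) fun ω => abs_ite_zero_le _ 1)]
      simp only [plays_eq_sum, Finset.sum_range_succ]
    have hd : ∫ p, (if p.2.2 = i then I else 0 : ℝ) ∂(choiceLaw L G θ init n) =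
        I * ∫ ω, (if (ω n).2.1.2 = i then 1 else 0 : ℝ) ∂(trajLaw L G θ init) := by
      rw [← map_choice, integral_map (by fun_prop) hdm.aestronglyMeasurable,
        ← integral_const_mul]
      simp
    rw [hC, mul_add, ← hd]
    simpa [choiceLaw] using hfin

end ChangeOfMeasure

/-! ### Rewards, actions and transitions -/

section Innovation

variable {S A 𝒳 : Type*} [MeasurableSpace S] [MeasurableSpace A] {M : ℕ} {D : MDP S A}
  {u : S → ℝ} {B : ℝ}

lemma abs_expNext_le (hu : ∀ s, |u s| ≤ B) (s : S) (a : A) : |D.expNext u s a| ≤ B :=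
  abs_integral_le_of_abs_le hu

/-- The difference between the value of `u` at the next state and its conditional expectation. -/
def innovation (D : MDP S A) (u : S → ℝ) (x y : Slot S A 𝒳 M) : ℝ :=
  u y.1 - D.expNext u x.1 x.2.1.1

lemma abs_innovation_le (hu : ∀ s, |u s| ≤ B) (x y : Slot S A 𝒳 M) :
    |innovation D u x y| ≤ 2 * B := by
  have h1 := abs_le.1 (hu y.1)
  have h2 := abs_le.1 (abs_expNext_le (D := D) hu x.1 x.2.1.1)
  rw [innovation, abs_le]
  constructor <;> linarith

/-- The sum of the first `n` innovations. -/
def innovationSum (D : MDP S A) (u : S → ℝ) (n : ℕ) (ω : ℕ → Slot S A 𝒳 M) : ℝ :=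
  ∑ t ∈ Finset.range n, innovation D u (ω t) (ω (t + 1))

lemma abs_innovationSum_le (hu : ∀ s, |u s| ≤ B) (n : ℕ) (ω : ℕ → Slot S A 𝒳 M) :
    |innovationSum D u n ω| ≤ n * (2 * B) := by
  refine (Finset.abs_sum_le_sum_abs _ _).trans
    ((Finset.sum_le_sum fun t _ => abs_innovation_le hu _ _).trans ?_)
  simp

end Innovation

section Mean

variable {Ψ A 𝒳 : Type*} [MeasurableSpace 𝒳] (G : GainModel Ψ A 𝒳)

lemma mean_eq_integral_law (a : A) (ψ : Ψ) : G.mean a ψ = ∫ x, G.f a x ∂(G.law ψ) := by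
  rw [GainModel.law, integral_withDensity_eq_integral_toReal_smul
    (G.measurable_g ψ).ennreal_ofReal (Eventually.of_forall fun _ => ENNReal.ofReal_lt_top)]
  simp only [ENNReal.toReal_ofReal (G.g_nonneg ψ _), smul_eq_mul, GainModel.mean, mul_comm]

lemma integrable_law (hA1 : G.A1) (a : A) (ψ : Ψ) : Integrable (G.f a) (G.law ψ) := by
  rw [GainModel.law, integrable_withDensity_iff (G.measurable_g ψ).ennreal_ofReal
    (Eventually.of_forall fun _ => ENNReal.ofReal_lt_top)]
  simpa only [ENNReal.toReal_ofReal (G.g_nonneg ψ _)] using hA1 ψ a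

end Mean

section Reward

variable {S A Ψ 𝒳 : Type*} [MeasurableSpace S] [Finite A] [MeasurableSpace A]
  [MeasurableSingletonClass A] [MeasurableSpace 𝒳] {M : ℕ} {D : MDP S A}
  (L : AllocationRule D 𝒳 M) (G : GainModel Ψ A 𝒳) (θ : Fin M → Ψ)
  (init : Measure S) [IsProbabilityMeasure init]

/-- The expected reward of a slot is the expectation of the mean rate of the choice. -/
lemma integrable_reward_and_integral_eq (hA1 : G.A1) (t : ℕ) :
    Integrable (reward G t) (trajLaw L G θ init) ∧
    ∫ ω, reward G t ω ∂(trajLaw L G θ init) =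
      ∫ ω, G.mean (ω t).2.1.1 (θ (ω t).2.1.2) ∂(trajLaw L G θ init) := by
  have hfm : Measurable fun p : ((((Fin t → Slot S A 𝒳 M) × S) × (A × Fin M)) × 𝒳) =>
      G.f p.1.2.1 p.2 :=
    (measurable_from_prod_countable_right G.measurable_f :
      Measurable fun q : A × 𝒳 => G.f q.1 q.2).comp
      (f := fun p : ((((Fin t → Slot S A 𝒳 M) × S) × (A × Fin M)) × 𝒳) => (p.1.2.1, p.2))
      (by fun_prop)
  have hint : Integrable (fun p : ((((Fin t → Slot S A 𝒳 M) × S) × (A × Fin M)) × 𝒳) =>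
      G.f p.1.2.1 p.2) ((trajLaw L G θ init).map (slotView t)) := by
    rw [map_slotView, Measure.integrable_compProd_iff hfm.aestronglyMeasurable]
    refine ⟨Eventually.of_forall fun p => integrable_law G hA1 p.2.1 (θ p.2.2), ?_⟩
    -- The conditional absolute moment depends only on the choice, which takes finitely many values;
    -- hence it is bounded although the gains need not be.
    obtain ⟨B, hB⟩ := (Set.finite_range fun q : A × Fin M =>
      |∫ x, ‖G.f q.1 x‖ ∂(G.law (θ q.2))|).bddAbove
    exact integrable_of_abs_le (B := B)
      ((measurable_of_countable fun q : A × Fin M => ∫ x, ‖G.f q.1 x‖ ∂(G.law (θ q.2))).comp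
        measurable_snd) fun p => hB ⟨p.2, rfl⟩
  have hmean : Measurable fun p : (((Fin t → Slot S A 𝒳 M) × S) × (A × Fin M)) =>
      G.mean p.2.1 (θ p.2.2) :=
    (measurable_of_countable fun q : A × Fin M => G.mean q.1 (θ q.2)).comp measurable_snd
  refine ⟨hint.comp_measurable (measurable_slotView t), ?_⟩
  have h1 := integral_map (μ := trajLaw L G θ init) (measurable_slotView t).aemeasurable
    hfm.aestronglyMeasurable
  have h2 := integral_map (μ := trajLaw L G θ init)
    (φ := fun ω => ((hist t ω, (ω t).1), (ω t).2.1)) (by fun_prop) hmean.aestronglyMeasurable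
  change ∫ ω, (fun p : ((((Fin t → Slot S A 𝒳 M) × S) × (A × Fin M)) × 𝒳) =>
      G.f p.1.2.1 p.2) (slotView t ω) ∂(trajLaw L G θ init) = _
  rw [← h1, ← h2, map_choice]
  rw [map_slotView] at hint ⊢
  rw [Measure.integral_compProd hint]
  refine integral_congr_ae (Eventually.of_forall fun p => ?_)
  exact (mean_eq_integral_law G p.2.1 (θ p.2.2)).symm

end Reward

section Dynamics

variable {S A Ψ 𝒳 : Type*} [Fintype S] [MeasurableSpace S] [MeasurableSingletonClass S]
  [Fintype A] [MeasurableSpace A] [MeasurableSingletonClass A] [MeasurableSpace 𝒳] {M : ℕ}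
  {D : MDP S A} (L : AllocationRule D 𝒳 M) (G : GainModel Ψ A 𝒳) (θ : Fin M → Ψ)
  (init : Measure S) [IsProbabilityMeasure init]

/-- The optimality inequality holds only for allowed actions, so the nonnegativity of the gaps is an
almost sure statement resting on this fact. -/
lemma ae_mem_allowed (t : ℕ) :
    ∀ᵐ ω ∂(trajLaw L G θ init), (ω t).2.1.1 ∈ D.allowed (ω t).1 := by
  have hset : MeasurableSet {p : (((Fin t → Slot S A 𝒳 M) × S) × (A × Fin M)) |
      p.2.1 ∈ D.allowed p.1.2} :=
    (Set.to_countable {q : S × A | q.2 ∈ D.allowed q.1}).measurableSet.preimage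
      (f := fun p : (((Fin t → Slot S A 𝒳 M) × S) × (A × Fin M)) => (p.1.2, p.2.1))
      (by fun_prop)
  have h : ∀ᵐ p ∂(choiceLaw L G θ init t), p.2.1 ∈ D.allowed p.1.2 := by
    rw [choiceLaw]
    refine Measure.ae_compProd_of_ae_ae hset (Eventually.of_forall fun p => ?_)
    exact L.choose_allowed t p.1 p.2
  rw [← map_choice] at h
  exact ae_of_ae_map (by fun_prop) h

variable {u : S → ℝ} {B : ℝ}

lemma measurable_innovation :
    Measurable fun p : Slot S A 𝒳 M × Slot S A 𝒳 M => innovation D u p.1 p.2 :=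
  ((measurable_of_countable u).comp (by fun_prop)).sub
    ((measurable_of_countable fun q : S × A => D.expNext u q.1 q.2).comp
      (f := fun p : Slot S A 𝒳 M × Slot S A 𝒳 M => (p.1.1, p.1.2.1.1)) (by fun_prop))

@[fun_prop]
lemma measurable_innovation_slots (n m : ℕ) :
    Measurable fun ω : ℕ → Slot S A 𝒳 M => innovation D u (ω n) (ω m) :=
  measurable_innovation.comp (f := fun ω : ℕ → Slot S A 𝒳 M => (ω n, ω m)) (by fun_prop)

/-- The innovations are orthogonal to the past. -/
lemma integral_mul_innovation (hu : ∀ s, |u s| ≤ B) {n : ℕ}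
    {W : (Fin (n + 1) → Slot S A 𝒳 M) → ℝ} {C : ℝ} (hW : Measurable W) (hC : ∀ h, |W h| ≤ C) :
    ∫ ω, W (hist (n + 1) ω) * innovation D u (ω n) (ω (n + 1)) ∂(trajLaw L G θ init) = 0 := by
  -- The integrand depends only on the history and the next state; integrating the next state first
  -- annihilates the second factor.
  let Φ : (Fin (n + 1) → Slot S A 𝒳 M) × S → ℝ := fun p =>
    W p.1 * (u p.2 - D.expNext u (p.1 (Fin.last n)).1 (p.1 (Fin.last n)).2.1.1)
  have hΦm : Measurable Φ := by
    refine (hW.comp measurable_fst).mul (((measurable_of_countable u).comp measurable_snd).sub ?_)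
    exact (measurable_of_countable fun q : S × A => D.expNext u q.1 q.2).comp
      (f := fun p : (Fin (n + 1) → Slot S A 𝒳 M) × S =>
        ((p.1 (Fin.last n)).1, (p.1 (Fin.last n)).2.1.1)) (by fun_prop)
  have hΦB : ∀ p, |Φ p| ≤ C * (2 * B) := by
    intro p
    rw [abs_mul]
    refine mul_le_mul (hC _) ?_ (abs_nonneg _) ((abs_nonneg _).trans (hC p.1))
    have h1 := abs_le.1 (hu p.2)
    have h2 := abs_le.1 (abs_expNext_le (D := D) hu (p.1 (Fin.last n)).1
      (p.1 (Fin.last n)).2.1.1)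
    rw [abs_le]
    constructor <;> linarith
  have h1 := integral_map (μ := trajLaw L G θ init)
    (φ := fun ω => (hist (n + 1) ω, (ω (n + 1)).1)) (by fun_prop) hΦm.aestronglyMeasurable
  change ∫ ω, Φ (hist (n + 1) ω, (ω (n + 1)).1) ∂(trajLaw L G θ init) = 0
  rw [← h1, map_hist_state, Measure.integral_compProd (integrable_of_abs_le hΦm hΦB)]
  refine integral_eq_zero_of_ae (Eventually.of_forall fun h => ?_)
  change ∫ s, W h * (u s - D.expNext u (h (Fin.last n)).1 (h (Fin.last n)).2.1.1)
    ∂(D.trans ((h (Fin.last n)).1, (h (Fin.last n)).2.1.1)) = 0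
  rw [integral_const_mul, integral_sub (integrable_of_abs_le (measurable_of_countable u) hu)
    (integrable_const _)]
  simp [MDP.expNext]

lemma integral_innovation (hu : ∀ s, |u s| ≤ B) (n : ℕ) :
    ∫ ω, innovation D u (ω n) (ω (n + 1)) ∂(trajLaw L G θ init) = 0 := by
  simpa using integral_mul_innovation L G θ init hu (n := n) (W := fun _ => 1) (C := 1)
    measurable_const (by simp)

@[fun_prop]
lemma measurable_innovationSum (n : ℕ) :
    Measurable (innovationSum D u n : (ℕ → Slot S A 𝒳 M) → ℝ) := by
  unfold innovationSum
  exact Finset.measurable_sum _ fun t _ => measurable_innovation_slots t (t + 1)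

lemma integral_add_two_mul_add {X : Type*} [MeasurableSpace X] {μ : Measure X} {f g k : X → ℝ}
    (hf : Integrable f μ) (hg : Integrable g μ) (hk : Integrable k μ) :
    ∫ x, f x + 2 * g x + k x ∂μ = ∫ x, f x ∂μ + 2 * ∫ x, g x ∂μ + ∫ x, k x ∂μ := by
  have hg' := hg.const_mul 2
  have hfg : Integrable (fun x => f x + 2 * g x) μ := hf.add hg'
  rw [integral_add hfg hk, integral_add hf hg', integral_const_mul]

/-- Orthogonality of the increments kills the cross terms, so the second moment grows only linearly;
by Chebyshev, a deviation of order `T` then has probability `O(1 / T)`. -/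
lemma integral_innovationSum_sq_le (hu : ∀ s, |u s| ≤ B) (n : ℕ) :
    ∫ ω, innovationSum D u n ω ^ 2 ∂(trajLaw L G θ init) ≤ n * (2 * B) ^ 2 := by
  induction n with
  | zero => simp [innovationSum]
  | succ n ih =>
    have hsq : ∀ {x C : ℝ}, |x| ≤ C → x ^ 2 ≤ C ^ 2 := fun h =>
      sq_le_sq' (abs_le.1 h).1 (abs_le.1 h).2
    have hi1 : Integrable (fun ω => innovationSum D u n ω ^ 2) (trajLaw L G θ init) :=
      integrable_of_abs_le (B := (n * (2 * B)) ^ 2) (by fun_prop) fun ω => by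
        rw [abs_of_nonneg (sq_nonneg _)]; exact hsq (abs_innovationSum_le hu n ω)
    have hi2 : Integrable (fun ω => innovation D u (ω n) (ω (n + 1)) ^ 2) (trajLaw L G θ init) :=
      integrable_of_abs_le (B := (2 * B) ^ 2) (by fun_prop) fun ω => by
        rw [abs_of_nonneg (sq_nonneg _)]; exact hsq (abs_innovation_le hu _ _)
    have hi3 : Integrable (fun ω => innovationSum D u n ω * innovation D u (ω n) (ω (n + 1)))
        (trajLaw L G θ init) :=
      integrable_of_abs_le (B := (n * (2 * B)) * (2 * B)) (by fun_prop) fun ω => by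
        rw [abs_mul]
        have h1 := abs_innovationSum_le (D := D) hu n ω
        exact mul_le_mul h1 (abs_innovation_le hu _ _) (abs_nonneg _) ((abs_nonneg _).trans h1)
    have h0 : ∫ ω, innovationSum D u n ω * innovation D u (ω n) (ω (n + 1))
        ∂(trajLaw L G θ init) = 0 := by
      -- The first `n` innovations involve the slots `0, …, n`, hence are a function of the history
      -- of length `n + 1`.
      have hW : Measurable fun h : Fin (n + 1) → Slot S A 𝒳 M =>
          ∑ t : Fin n, innovation D u (h t.castSucc) (h t.succ) :=
        Finset.measurable_sum _ fun t _ => measurable_innovation.comp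
          (f := fun h : Fin (n + 1) → Slot S A 𝒳 M => (h t.castSucc, h t.succ)) (by fun_prop)
      have := integral_mul_innovation L G θ init hu hW (C := n * (2 * B)) fun h => by
        refine (Finset.abs_sum_le_sum_abs _ _).trans
          ((Finset.sum_le_sum fun t _ => abs_innovation_le hu _ _).trans ?_)
        simp
      rw [← this]
      refine integral_congr_ae (Eventually.of_forall fun ω => ?_)
      simp only [innovationSum, hist, Finset.sum_range, Fin.val_castSucc, Fin.val_succ]
    have h1 : ∀ ω : ℕ → Slot S A 𝒳 M, innovationSum D u (n + 1) ω ^ 2 =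
        innovationSum D u n ω ^ 2 + 2 * (innovationSum D u n ω * innovation D u (ω n) (ω (n + 1)))
          + innovation D u (ω n) (ω (n + 1)) ^ 2 := fun ω => by
      rw [innovationSum, Finset.sum_range_succ, ← innovationSum]; ring
    have h2 : ∫ ω, innovation D u (ω n) (ω (n + 1)) ^ 2 ∂(trajLaw L G θ init) ≤ (2 * B) ^ 2 := by
      have := integral_mono hi2 (integrable_const ((2 * B) ^ 2))
        fun ω => hsq (abs_innovation_le hu _ _)
      simpa using this
    simp only [h1]
    rw [integral_add_two_mul_add hi1 hi3 hi2, h0]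
    push_cast
    linarith

end Dynamics

/-! ### Benchmarks under a change of one channel -/

section Benchmark

variable {S A Ψ 𝒳 : Type*} [MeasurableSpace 𝒳] {M : ℕ} (G : GainModel Ψ A 𝒳)

lemma mean_le_bestMean (θ : Fin M → Ψ) (a : A) (k : Fin M) : G.mean a (θ k) ≤ bestMean G θ a :=
  le_ciSup (f := fun k => G.mean a (θ k)) (Set.finite_range _).bddAbove k

lemma exists_mean_eq_bestMean [Nonempty (Fin M)] (θ : Fin M → Ψ) (a : A) :
    ∃ k, G.mean a (θ k) = bestMean G θ a := by
  obtain ⟨k, hk⟩ := Finite.exists_max fun k => G.mean a (θ k)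
  exact ⟨k, le_antisymm (mean_le_bestMean G θ a k) (ciSup_le hk)⟩

variable [Fintype S] [MeasurableSpace S] [MeasurableSpace A]

lemma avgReward_le_optReward [Finite A] (D : MDP S A) (θ : Fin M → Ψ) (β : D.Policy) :
    avgReward D G θ β ≤ optReward D G θ :=
  le_ciSup (f := fun β => avgReward D G θ β) (Set.finite_range _).bddAbove β

variable [Finite A] [DecidableEq S] [MeasurableSingletonClass S] (D : MDP S A)

/-- Some channel is optimal. -/
lemma optimalChannels_nonempty [Nonempty S] [Nonempty (Fin M)] (hD : D.IsErgodic)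
    (θ : Fin M → Ψ) : (optimalChannels D G θ).Nonempty := by
  obtain ⟨β, hβ⟩ := Finite.exists_max fun β : D.Policy => avgReward D G θ β
  obtain ⟨s⟩ := ‹Nonempty S›
  obtain ⟨j, hj⟩ := Finite.exists_max fun k => G.mean (β s) (θ k)
  have : Nonempty S := ⟨s⟩
  exact ⟨j, β, hβ, s, D.stationaryDist_pos hD β s, hj⟩

/-- Replacing a channel by a copy of another one does not improve the benchmark. -/
lemma optReward_update_le [Nonempty S] (θ : Fin M → Ψ) (i j : Fin M) :
    optReward D G (Function.update θ i (θ j)) ≤ optReward D G θ := by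
  have : Nonempty (Fin M) := ⟨i⟩
  refine ciSup_le fun β => le_trans (Finset.sum_le_sum fun s _ => ?_)
    (avgReward_le_optReward G D θ β)
  refine mul_le_mul_of_nonneg_left (ciSup_le fun k => ?_)
    ((D.isStationary_stationaryDist β).1.1 s)
  by_cases hk : k = i
  · subst hk; rw [Function.update_self]; exact mean_le_bestMean G θ _ j
  · rw [Function.update_of_ne hk]; exact mean_le_bestMean G θ _ k

/-- Making a suboptimal channel better than an optimal one improves the benchmark. -/
lemma optReward_lt_update [Nonempty S] (hD : D.IsErgodic) {θ : Fin M → Ψ} {i j : Fin M}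
    (hi : i ∉ optimalChannels D G θ) {β : D.Policy}
    (hβ : ∀ β' : D.Policy, avgReward D G θ β' ≤ avgReward D G θ β) {s : S}
    (hj : ∀ k : Fin M, G.mean (β s) (θ k) ≤ G.mean (β s) (θ j)) {ψ : Ψ}
    (hψ : G.mean (β s) (θ j) < G.mean (β s) ψ) :
    optReward D G θ < optReward D G (Function.update θ i ψ) := by
  have : Nonempty (Fin M) := ⟨i⟩
  have hopt : optReward D G θ ≤ avgReward D G θ β := ciSup_le hβ
  refine hopt.trans_lt (lt_of_lt_of_le ?_ (avgReward_le_optReward G D _ β))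
  have hpos := D.stationaryDist_pos hD β
  refine Finset.sum_lt_sum (fun x _ => mul_le_mul_of_nonneg_left ?_ (hpos x).le)
    ⟨s, Finset.mem_univ s, mul_lt_mul_of_pos_left ?_ (hpos s)⟩
  · obtain ⟨k, hk⟩ := exists_mean_eq_bestMean G θ (β x : A)
    -- All states have positive stationary probability, so a channel that is best for any action
    -- used by `β` is optimal. Thus the best channels survive the replacement of `i`, and no term of
    -- the average drops.
    have hki : k ≠ i := by
      rintro rfl
      exact hi ⟨β, hβ, x, hpos x, fun l => hk ▸ mean_le_bestMean G θ _ l⟩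
    rw [← hk, ← Function.update_of_ne hki ψ θ]
    exact mean_le_bestMean G _ _ k
  · calc bestMean G θ (β s) ≤ G.mean (β s) (θ j) := ciSup_le hj
      _ < G.mean (β s) (Function.update θ i ψ i) := by rwa [Function.update_self]
      _ ≤ _ := mean_le_bestMean G _ _ i

end Benchmark

/-! ### A good rule rarely neglects a necessary channel -/

section Gap

variable {S A Ψ 𝒳 : Type*} [MeasurableSpace S] [MeasurableSpace A] {M : ℕ}

/-- The loss, relative to the average reward `ρ` and the bias `h`, of the choice of slot `t`. -/
def gap [MeasurableSpace 𝒳] (D : MDP S A) (G : GainModel Ψ A 𝒳) (θ : Fin M → Ψ) (ρ : ℝ) (h : S → ℝ) (t : ℕ)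
    (ω : ℕ → Slot S A 𝒳 M) : ℝ :=
  ρ + h (ω t).1 - G.mean (ω t).2.1.1 (θ (ω t).2.1.2) - D.expNext h (ω t).1 (ω t).2.1.1

lemma exists_bound {X : Type*} [Finite X] (u : X → ℝ) : ∃ B, 0 ≤ B ∧ ∀ x, |u x| ≤ B := by
  obtain ⟨B, hB⟩ := (Set.finite_range fun x => |u x|).bddAbove
  exact ⟨max B 0, le_max_right _ _, fun x => (hB ⟨x, rfl⟩).trans (le_max_left _ _)⟩

/-- Trading the expected next value for the actual one costs an innovation; what remains telescopes.
-/
lemma sum_sub_expNext (D : MDP S A) (u : S → ℝ) (T : ℕ) (ω : ℕ → Slot S A 𝒳 M) :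
    ∑ t ∈ Finset.range T, (u (ω t).1 - D.expNext u (ω t).1 (ω t).2.1.1) =
      u (ω 0).1 - u (ω T).1 + innovationSum D u T ω := by
  rw [innovationSum, ← Finset.sum_range_sub' (fun t => u (ω t).1), ← Finset.sum_add_distrib]
  exact Finset.sum_congr rfl fun t _ => by rw [innovation]; ring

end Gap

section Concentration

variable {S A Ψ 𝒳 : Type*} [Fintype S] [MeasurableSpace S] [MeasurableSingletonClass S]
  [Fintype A] [MeasurableSpace A] [MeasurableSingletonClass A] [MeasurableSpace 𝒳] {M : ℕ}
  {D : MDP S A} (L : AllocationRule D 𝒳 M) (G : GainModel Ψ A 𝒳) (θ : Fin M → Ψ)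
  (init : Measure S) [IsProbabilityMeasure init]

lemma integrable_innovationSum {u : S → ℝ} {B : ℝ} (hu : ∀ s, |u s| ≤ B) (T : ℕ) :
    Integrable (innovationSum D u T) (trajLaw L G θ init) :=
  integrable_of_abs_le (measurable_innovationSum T) (abs_innovationSum_le hu T)

lemma integral_innovationSum {u : S → ℝ} {B : ℝ} (hu : ∀ s, |u s| ≤ B) (T : ℕ) :
    ∫ ω, innovationSum D u T ω ∂(trajLaw L G θ init) = 0 := by
  unfold innovationSum
  rw [integral_finsetSum _ fun t _ =>
    integrable_of_abs_le (measurable_innovation_slots t (t + 1)) fun ω => abs_innovation_le hu _ _]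
  exact Finset.sum_eq_zero fun t _ => integral_innovation L G θ init hu t

/-- The regret controls the expected accumulated gap. -/
lemma integral_sum_gap_le (hA1 : G.A1) {h : S → ℝ} {B : ℝ} (hB : ∀ s, |h s| ≤ B) (T : ℕ) :
    Integrable (fun ω => ∑ t ∈ Finset.range T, gap D G θ (optReward D G θ) h t ω)
      (trajLaw L G θ init) ∧
    ∫ ω, ∑ t ∈ Finset.range T, gap D G θ (optReward D G θ) h t ω ∂(trajLaw L G θ init) ≤
      regret L G θ init T + 2 * B := by
  set P := trajLaw L G θ init
  set ρ := optReward D G θ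
  have hmeanI : ∀ t, Integrable (fun ω : ℕ → Slot S A 𝒳 M =>
      G.mean (ω t).2.1.1 (θ (ω t).2.1.2)) P := fun t => by
    obtain ⟨C, -, hC⟩ := exists_bound fun q : A × Fin M => G.mean q.1 (θ q.2)
    exact integrable_of_abs_le (B := C)
      ((measurable_of_countable fun q : A × Fin M => G.mean q.1 (θ q.2)).comp (by fun_prop))
      fun ω => hC (ω t).2.1
  have hsumI : Integrable (fun ω : ℕ → Slot S A 𝒳 M =>
      ∑ t ∈ Finset.range T, G.mean (ω t).2.1.1 (θ (ω t).2.1.2)) P :=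
    integrable_finsetSum _ fun t _ => hmeanI t
  have hrew : ∫ ω, ∑ t ∈ Finset.range T, reward G t ω ∂P =
      ∫ ω, ∑ t ∈ Finset.range T, G.mean (ω t).2.1.1 (θ (ω t).2.1.2) ∂P := by
    rw [integral_finsetSum _ fun t _ => (integrable_reward_and_integral_eq L G θ init hA1 t).1,
      integral_finsetSum _ fun t _ => hmeanI t]
    exact Finset.sum_congr rfl fun t _ => (integrable_reward_and_integral_eq L G θ init hA1 t).2
  have hend : ∀ t, Integrable (fun ω : ℕ → Slot S A 𝒳 M => h (ω t).1) P := fun t =>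
    integrable_of_abs_le ((measurable_of_countable h).comp (by fun_prop)) fun ω => hB _
  have hgap : ∀ ω : ℕ → Slot S A 𝒳 M, ∑ t ∈ Finset.range T, gap D G θ ρ h t ω =
      (T * ρ - ∑ t ∈ Finset.range T, G.mean (ω t).2.1.1 (θ (ω t).2.1.2)) +
        ((h (ω 0).1 - h (ω T).1) + innovationSum D h T ω) := fun ω => by
    rw [← sum_sub_expNext]
    have : (T : ℝ) * ρ = ∑ t ∈ Finset.range T, ρ := by simp
    rw [this, ← Finset.sum_sub_distrib, ← Finset.sum_add_distrib]
    exact Finset.sum_congr rfl fun t _ => by rw [gap]; ring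
  have hinn := integrable_innovationSum L G θ init hB T
  have hI1 : Integrable (fun ω : ℕ → Slot S A 𝒳 M =>
      T * ρ - ∑ t ∈ Finset.range T, G.mean (ω t).2.1.1 (θ (ω t).2.1.2)) P :=
    (integrable_const _).sub hsumI
  have hI2 : Integrable (fun ω : ℕ → Slot S A 𝒳 M => h (ω 0).1 - h (ω T).1) P :=
    (hend 0).sub (hend T)
  have hI3 : Integrable (fun ω : ℕ → Slot S A 𝒳 M =>
      (h (ω 0).1 - h (ω T).1) + innovationSum D h T ω) P := hI2.add hinn
  have h2 : ∫ ω, (h (ω 0).1 - h (ω T).1) ∂P ≤ 2 * B := by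
    have := integral_mono hI2 (integrable_const (2 * B)) fun ω => by
      have h1 := abs_le.1 (hB (ω 0).1)
      have h2 := abs_le.1 (hB (ω T).1)
      change h (ω 0).1 - h (ω T).1 ≤ 2 * B
      linarith
    simpa using this
  simp only [hgap]
  refine ⟨hI1.add hI3, ?_⟩
  rw [integral_add hI1 hI3, integral_add hI2 hinn, integral_innovationSum L G θ init hB,
    integral_sub (integrable_const _) hsumI, ← hrew]
  simp only [regret, integral_const, probReal_univ, one_smul]
  linarith

variable [DecidableEq S]

/-- The probability that the channel `i` is played less than `η T` times, when the benchmark drops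
without that channel. -/
lemma exists_measure_plays_lt_le [Nonempty S] (hD : D.IsErgodic) (hA1 : G.A1) {i : Fin M}
    {θ' : Fin M → Ψ} (hθ : ∀ k, k ≠ i → θ' k = θ k) (hlt : optReward D G θ' < optReward D G θ) :
    ∃ η B C : ℝ, 0 < η ∧ 0 ≤ B ∧ 0 < C ∧ ∀ᶠ T : ℕ in atTop,
      (trajLaw L G θ init).real {ω | (plays i T ω : ℝ) < η * T} ≤
        C * ((regret L G θ init T + B) / T + B / T) := by
  obtain ⟨h, hh⟩ := D.exists_bias hD (bestMean G θ)
  obtain ⟨h', hh'⟩ := D.exists_bias hD (bestMean G θ')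
  change ∀ s, ∀ a ∈ D.allowed s, _ ≤ optReward D G θ + h s at hh
  change ∀ s, ∀ a ∈ D.allowed s, _ ≤ optReward D G θ' + h' s at hh'
  set P := trajLaw L G θ init
  set ρ := optReward D G θ
  set ρ' := optReward D G θ'
  obtain ⟨B, hB0, hB⟩ := exists_bound h
  obtain ⟨B', hB0', hB'⟩ := exists_bound fun s => h s - h' s
  -- `K` bounds the most that a play of channel `i` can gain over the benchmark without it.
  obtain ⟨K, hK0, hK⟩ := exists_bound fun a => G.mean a (θ i) - bestMean G θ' a
  set Δ := ρ - ρ' with hΔ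
  have hΔ0 : 0 < Δ := sub_pos.2 hlt
  let u : S → ℝ := fun s => h s - h' s
  have hexp : ∀ s a, D.expNext u s a = D.expNext h s a - D.expNext h' s a := fun s a =>
    integral_sub Integrable.of_finite Integrable.of_finite
  -- The bias `h` gives nonnegativity. The bias `h'` bounds the mean rate of any channel other than
  -- `i` in terms of `ρ'`, so subtracting the two leaves `Δ` and the drift of `u = h - h'`.
  have hgap : ∀ᵐ ω ∂P, ∀ t, 0 ≤ gap D G θ ρ h t ω ∧
      Δ - K * (if (ω t).2.1.2 = i then 1 else 0) +
        (u (ω t).1 - D.expNext u (ω t).1 (ω t).2.1.1) ≤ gap D G θ ρ h t ω := by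
    filter_upwards [ae_all_iff.2 fun t => ae_mem_allowed L G θ init t] with ω hω t
    have h1 := hh _ _ (hω t)
    have h2 := hh' _ _ (hω t)
    have h3 := mean_le_bestMean G θ (ω t).2.1.1 (ω t).2.1.2
    rw [gap, hexp]
    refine ⟨by linarith, ?_⟩
    split_ifs with hi
    · have h4 := (abs_le.1 (hK (ω t).2.1.1)).2
      rw [hi]
      simp only [u]
      linarith
    · have h4 := mean_le_bestMean G θ' (ω t).2.1.1 (ω t).2.1.2
      rw [hθ _ hi] at h4
      simp only [u]
      linarith
  have hsum : ∀ T : ℕ, ∀ᵐ ω ∂P, 0 ≤ ∑ t ∈ Finset.range T, gap D G θ ρ h t ω ∧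
      Δ * T - K * plays i T ω - 2 * B' - |innovationSum D u T ω| ≤
        ∑ t ∈ Finset.range T, gap D G θ ρ h t ω := by
    intro T
    filter_upwards [hgap] with ω hω
    refine ⟨Finset.sum_nonneg fun t _ => (hω t).1, ?_⟩
    refine le_trans ?_ (Finset.sum_le_sum fun t _ => (hω t).2)
    rw [Finset.sum_add_distrib, sum_sub_expNext, Finset.sum_sub_distrib, ← Finset.mul_sum,
      ← plays_eq_sum]
    have h1 := abs_le.1 (hB' (ω 0).1)
    have h2 := abs_le.1 (hB' (ω T).1)
    have h3 := neg_abs_le (innovationSum D u T ω)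
    simp only [Finset.sum_const, Finset.card_range, nsmul_eq_mul, u] at h3 ⊢
    linarith
  -- The budget `Δ T` is split into four quarters: plays of `i` (hence this `η`, with `K + 1`
  -- avoiding a zero denominator), the boundary term `2 B'` for large `T`, the innovation sum, and
  -- the accumulated gap. If the first three stay within their quarters, the gap must fill the
  -- fourth.
  refine ⟨Δ / (4 * (K + 1)), 2 * B + (2 * B') ^ 2, 4 / Δ + 16 / Δ ^ 2, by positivity,
    by positivity, by positivity, ?_⟩
  have hlarge : ∀ᶠ T : ℕ in atTop, 8 * B' / Δ ≤ T := tendsto_natCast_atTop_atTop.eventually_ge_atTop _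
  filter_upwards [hlarge, eventually_gt_atTop 0] with T hT hT0
  have hTpos : (0 : ℝ) < T := Nat.cast_pos.2 hT0
  rw [div_le_iff₀ hΔ0] at hT
  obtain ⟨hgI, hgle⟩ := integral_sum_gap_le L G θ init hA1 hB T
  have hε : 0 < Δ * T / 4 := by positivity
  have hm1 := mul_meas_ge_le_integral_of_nonneg ((hsum T).mono fun ω hω => hω.1) hgI (Δ * T / 4)
  have hisq : Integrable (fun ω => innovationSum D u T ω ^ 2) P :=
    integrable_of_abs_le (B := (T * (2 * B')) ^ 2) (by fun_prop) fun ω => by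
      rw [abs_of_nonneg (sq_nonneg _)]
      have := abs_le.1 (abs_innovationSum_le (D := D) hB' T ω)
      exact sq_le_sq' this.1 this.2
  have hm2 := mul_meas_ge_le_integral_of_nonneg (Eventually.of_forall fun ω => sq_nonneg
    (innovationSum D u T ω)) hisq ((Δ * T / 4) ^ 2)
  have hm3 := integral_innovationSum_sq_le L G θ init hB' T
  have hcover : P.real {ω | (plays i T ω : ℝ) < Δ / (4 * (K + 1)) * T} ≤
      P.real {ω | Δ * T / 4 ≤ ∑ t ∈ Finset.range T, gap D G θ ρ h t ω} +
      P.real {ω | (Δ * T / 4) ^ 2 ≤ innovationSum D u T ω ^ 2} := by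
    refine le_trans ?_ (measureReal_union_le _ _)
    refine ENNReal.toReal_mono (measure_ne_top _ _) (measure_mono_ae ?_)
    filter_upwards [hsum T] with ω hω hlt
    change (plays i T ω : ℝ) < Δ / (4 * (K + 1)) * T at hlt
    change Δ * T / 4 ≤ ∑ t ∈ Finset.range T, gap D G θ ρ h t ω ∨
      (Δ * T / 4) ^ 2 ≤ innovationSum D u T ω ^ 2
    by_contra! hcon
    have h1 : |innovationSum D u T ω| < Δ * T / 4 := by
      rw [← sq_abs] at hcon
      exact lt_of_pow_lt_pow_left₀ 2 hε.le hcon.2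
    have h2 : K * plays i T ω ≤ Δ * T / 4 := by
      have h3 : (K + 1) * (plays i T ω : ℝ) ≤ (K + 1) * (Δ / (4 * (K + 1)) * T) :=
        mul_le_mul_of_nonneg_left hlt.le (by positivity)
      have h4 : (K + 1) * (Δ / (4 * (K + 1)) * T) = Δ * T / 4 := by field_simp
      have h5 : (0 : ℝ) ≤ plays i T ω := Nat.cast_nonneg _
      linarith
    linarith [hω.2, hcon.1]
  -- The regret may be negative, but by no more than the boundary constant; this lets both tail
  -- bounds be dominated by the same expression.
  have hR0 : 0 ≤ regret L G θ init T + 2 * B :=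
    (integral_nonneg_of_ae ((hsum T).mono fun ω hω => hω.1)).trans hgle
  have hp1 : P.real {ω | Δ * T / 4 ≤ ∑ t ∈ Finset.range T, gap D G θ ρ h t ω} ≤
      4 / Δ * ((regret L G θ init T + 2 * B) / T) := by
    rw [show 4 / Δ * ((regret L G θ init T + 2 * B) / T) =
      (regret L G θ init T + 2 * B) / (Δ * T / 4) by field_simp, le_div_iff₀' hε]
    exact hm1.trans hgle
  have hp2 : P.real {ω | (Δ * T / 4) ^ 2 ≤ innovationSum D u T ω ^ 2} ≤
      16 / Δ ^ 2 * ((2 * B') ^ 2 / T) := by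
    rw [show 16 / Δ ^ 2 * ((2 * B') ^ 2 / T) = T * (2 * B') ^ 2 / (Δ * T / 4) ^ 2 by
      field_simp; ring, le_div_iff₀' (by positivity)]
    exact hm2.trans hm3
  refine hcover.trans ((add_le_add hp1 hp2).trans ?_)
  have hx : (regret L G θ init T + 2 * B) / T ≤
      (regret L G θ init T + (2 * B + (2 * B') ^ 2)) / T +
        (2 * B + (2 * B') ^ 2) / T := by
    rw [← add_div]
    exact div_le_div_of_nonneg_right (by linarith [sq_nonneg (2 * B')]) hTpos.le
  have hy : (2 * B') ^ 2 / T ≤ (regret L G θ init T + (2 * B + (2 * B') ^ 2)) / T +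
        (2 * B + (2 * B') ^ 2) / T := by
    rw [← add_div]
    exact div_le_div_of_nonneg_right (by linarith [sq_nonneg (2 * B')]) hTpos.le
  rw [add_mul]
  exact add_le_add (mul_le_mul_of_nonneg_left hx (by positivity))
    (mul_le_mul_of_nonneg_left hy (by positivity))

end Concentration

/-! ### The lower bound -/

section LowerBound

variable {S A Ψ 𝒳 : Type*} [MeasurableSpace S] [MeasurableSpace A] [MeasurableSpace 𝒳] {M : ℕ}
  {D : MDP S A} (L : AllocationRule D 𝒳 M) (G : GainModel Ψ A 𝒳)
  (init : Measure S) [IsProbabilityMeasure init]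

/-- If neglecting the channel `i` is rare under `θ'`, then it is played often under `θ`. -/
lemma log_mul_measure_le {θ θ' : Fin M → Ψ} {i : Fin M} (hθ : ∀ k, k ≠ i → θ' k = θ k)
    (hI : G.I (θ i) (θ' i) ≠ ∞) {T : ℕ} {η d C : ℝ} (hT : 0 < T)
    (hC : (trajLaw L G θ' init).real {ω | (plays i T ω : ℝ) < η * T} ≤ C * (T : ℝ) ^ (-d)) :
    d * Real.log T * (trajLaw L G θ init).real {ω | (plays i T ω : ℝ) < η * T} ≤
      (G.I (θ i) (θ' i)).toReal * ∫ ω, (plays i T ω : ℝ) ∂(trajLaw L G θ init) +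
        Real.log (1 + C) := by
  have hTpos : (0 : ℝ) < T := Nat.cast_pos.2 hT
  let N : (Fin T → Slot S A 𝒳 M) → ℝ := fun h => ∑ t : Fin T, if (h t).2.1.2 = i then 1 else 0
  have hN : Measurable N := Finset.measurable_sum _ fun t _ =>
    (measurable_of_countable fun k : Fin M => if k = i then (1 : ℝ) else 0).comp
      (f := fun h : Fin T → Slot S A 𝒳 M => (h t).2.1.2) (by fun_prop)
  have hNp : ∀ ω : ℕ → Slot S A 𝒳 M, N (hist T ω) = plays i T ω := fun ω => by
    rw [plays_eq_sum, Finset.sum_range]; rfl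
  let E : Set (Fin T → Slot S A 𝒳 M) := {h | N h < η * T}
  have hE : MeasurableSet E := measurableSet_lt hN measurable_const
  have hpre : hist T ⁻¹' E = {ω : ℕ → Slot S A 𝒳 M | (plays i T ω : ℝ) < η * T} := by
    ext ω
    simp only [E, Set.mem_preimage, Set.mem_ofPred_eq, hNp]
  have hreal : ∀ ϑ : Fin M → Ψ, (histLaw L G ϑ init T).real E =
      (trajLaw L G ϑ init).real {ω | (plays i T ω : ℝ) < η * T} := fun ϑ => by
    rw [← hpre, histLaw, map_measureReal_apply (measurable_hist T) hE]
  -- On `E` the exponential of `φ` is `T ^ d`, which exactly compensates the probability `C * T ^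
  -- (-d)` of `E` under `θ'`.
  let φ : (Fin T → Slot S A 𝒳 M) → ℝ := E.indicator fun _ => d * Real.log T
  have hφm : Measurable φ := measurable_const.indicator hE
  have hφB : ∀ h, |φ h| ≤ |d * Real.log T| := fun h => by
    by_cases hh : h ∈ E
    · simp [φ, hh]
    · simpa only [φ, Set.indicator_of_notMem hh, abs_zero] using abs_nonneg _
  have hdv := dvBound_histLaw L G init hθ hI T φ _ hφm hφB
  have h1 : ∫ h, φ h ∂(histLaw L G θ init T) = d * Real.log T *
      (trajLaw L G θ init).real {ω | (plays i T ω : ℝ) < η * T} := by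
    rw [integral_indicator_const _ hE, smul_eq_mul, hreal, mul_comm]
  have h2 : ∫ h, Real.exp (φ h) ∂(histLaw L G θ' init T) ≤ 1 + C := by
    have hexp : Integrable (fun h => Real.exp (φ h)) (histLaw L G θ' init T) :=
      integrable_of_abs_le hφm.exp fun h => exp_le_of_abs_le (hφB h)
    have hind : Integrable (E.indicator fun _ => (T : ℝ) ^ d) (histLaw L G θ' init T) :=
      (integrable_const _).indicator hE
    have hle := integral_mono hexp ((integrable_const (1 : ℝ)).add hind) fun h => by
      change Real.exp (φ h) ≤ 1 + E.indicator (fun _ => (T : ℝ) ^ d) h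
      by_cases hh : h ∈ E
      · simp only [φ, Set.indicator_of_mem hh]
        rw [mul_comm, ← Real.rpow_def_of_pos hTpos]
        linarith
      · simp [φ, hh]
    refine hle.trans ?_
    rw [integral_add' (integrable_const _) hind, integral_indicator_const _ hE, hreal]
    have h3 := mul_le_mul_of_nonneg_right hC (Real.rpow_nonneg hTpos.le d)
    rw [mul_assoc, ← Real.rpow_add hTpos, neg_add_cancel, Real.rpow_zero, mul_one] at h3
    simpa using h3
  rw [h1] at hdv
  exact hdv.trans (add_le_add_right
    (Real.log_le_log (abs_log_integral_exp_le hφm hφB).2 h2) _)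

/-- Markov's inequality for the number of plays. The bound is near one when the expected number of
plays is sublinear. -/
lemma one_sub_le_measure_plays_lt (θ : Fin M → Ψ) (i : Fin M) {T : ℕ} {η : ℝ} (hη : 0 < η)
    (hT : 0 < T) :
    1 - (∫ ω, (plays i T ω : ℝ) ∂(trajLaw L G θ init)) / (η * T) ≤
      (trajLaw L G θ init).real {ω | (plays i T ω : ℝ) < η * T} := by
  have hpos : 0 < η * T := mul_pos hη (Nat.cast_pos.2 hT)
  have h1 := mul_meas_ge_le_integral_of_nonneg (Eventually.of_forall fun ω => Nat.cast_nonneg _)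
    (integrable_plays L G init θ i T) (η * T)
  have h2 : {ω : ℕ → Slot S A 𝒳 M | (plays i T ω : ℝ) < η * T} =
      {ω | η * T ≤ (plays i T ω : ℝ)}ᶜ := by ext ω; simp
  rw [h2, probReal_compl_eq_one_sub (measurableSet_le measurable_const (measurable_plays i T))]
  have h3 := (le_div_iff₀' hpos).2 h1
  linarith

/-- Solving a self-bounding inequality for the growth relative to the logarithm. -/
lemma eventually_le_div_log {x : ℕ → ℝ} {I η d C c : ℝ} (hI : 0 ≤ I)
    (hη : 0 < η) (hd : 0 < d) (hc : c * I < d)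
    (h : ∀ᶠ T : ℕ in atTop, d * Real.log T * (1 - x T / (η * T)) ≤ I * x T + C) :
    ∀ᶠ T : ℕ in atTop, c ≤ x T / Real.log T := by
  have hlog : Tendsto (fun T : ℕ => Real.log T) atTop atTop :=
    Real.tendsto_log_atTop.comp tendsto_natCast_atTop_atTop
  have hdiv : Tendsto (fun T : ℕ => Real.log T / T) atTop (nhds 0) := by
    have := Real.isLittleO_log_id_atTop.tendsto_div_nhds_zero
    exact this.comp tendsto_natCast_atTop_atTop
  have hlim : Tendsto (fun T : ℕ => d * (1 - c / η * (Real.log T / T)) - C / Real.log T) atTop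
      (nhds (d * (1 - c / η * 0) - 0)) :=
    (((hdiv.const_mul _).const_sub 1).const_mul d).sub (hlog.const_div_atTop C)
  rw [mul_zero, sub_zero, sub_zero, mul_one] at hlim
  filter_upwards [h, hlim.eventually_const_lt hc, hlog.eventually_gt_atTop 0,
    eventually_gt_atTop 0] with T h1 h2 h3 hT
  have hTpos : (0 : ℝ) < T := Nat.cast_pos.2 hT
  by_contra! hlt
  rw [div_lt_iff₀ h3] at hlt
  -- If `x T < c * log T`, both sides of the hypothesis can be relaxed to this value; after division
  -- by `log T` the limit would give `d ≤ c * I`.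
  have h4 : d * Real.log T * (1 - c * Real.log T / (η * T)) ≤ I * (c * Real.log T) + C := by
    refine le_trans (mul_le_mul_of_nonneg_left ?_ (by positivity)) (h1.trans ?_)
    · have : x T / (η * T) ≤ c * Real.log T / (η * T) := by gcongr
      linarith
    · have := mul_le_mul_of_nonneg_left hlt.le hI
      linarith
  have h5 := mul_lt_mul_of_pos_right h2 h3
  have h6 : (d * (1 - c / η * (Real.log T / T)) - C / Real.log T) * Real.log T =
      d * Real.log T * (1 - c * Real.log T / (η * T)) - C := by
    field_simp
  rw [h6] at h5
  linarith

end LowerBound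

section Consistency

variable {S A Ψ 𝒳 : Type*} [Fintype S] [DecidableEq S] [MeasurableSpace S]
  [MeasurableSingletonClass S] [Fintype A] [MeasurableSpace A] [MeasurableSingletonClass A]
  [MeasurableSpace 𝒳] {M : ℕ} {D : MDP S A} (L : AllocationRule D 𝒳 M) (G : GainModel Ψ A 𝒳)
  (init : Measure S) [IsProbabilityMeasure init]

/-- Under sublinear regret, rarely using a necessary channel has polynomially small probability. -/
lemma exists_measure_plays_lt_le_rpow [Nonempty S] (hD : D.IsErgodic) (hA1 : G.A1) {i : Fin M}
    {θ θ' : Fin M → Ψ} (hθ : ∀ k, k ≠ i → θ' k = θ k)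
    (hlt : optReward D G θ' < optReward D G θ) {b : ℝ} (hb : 0 < b)
    (hL : (fun T : ℕ => regret L G θ init T) =o[atTop] fun T : ℕ => (T : ℝ) ^ b) :
    ∃ η C : ℝ, 0 < η ∧ 0 < C ∧ ∀ᶠ T : ℕ in atTop,
      (trajLaw L G θ init).real {ω | (plays i T ω : ℝ) < η * T} ≤ C * (T : ℝ) ^ (-(1 - b)) := by
  obtain ⟨η, B, C, hη, hB, hC, h⟩ := exists_measure_plays_lt_le L G θ init hD hA1 hθ hlt
  refine ⟨η, C * (1 + 2 * B), hη, by positivity, ?_⟩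
  filter_upwards [h, hL.bound one_pos, eventually_ge_atTop 1] with T h1 h2 hT
  have hT1 : (1 : ℝ) ≤ T := Nat.one_le_cast.2 hT
  have hTpos : (0 : ℝ) < T := by linarith
  have hb1 : 1 ≤ (T : ℝ) ^ b := Real.one_le_rpow hT1 hb.le
  have h3 : regret L G θ init T ≤ (T : ℝ) ^ b := by
    rw [one_mul, Real.norm_eq_abs, Real.norm_of_nonneg (by linarith)] at h2
    exact (le_abs_self _).trans h2
  refine h1.trans ?_
  rw [mul_assoc, neg_sub, Real.rpow_sub_one hTpos.ne', ← add_div, ← mul_div_assoc (1 + 2 * B)]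
  refine mul_le_mul_of_nonneg_left (div_le_div_of_nonneg_right ?_ hTpos.le) hC.le
  -- Since `T ^ b ≥ 1`, the additive constants `2 * B` are absorbed into `2 * B * T ^ b`.
  nlinarith

/-- Every constant below the inverse divergence is eventually a lower bound. -/
lemma eventually_le_integral_plays_div_log [Nonempty S] (hD : D.IsErgodic)
    (hA1 : G.A1) (hA2 : G.A2) (hA3 : G.A3) (hA4 : G.A4)
    (hL : ∀ (θ : Fin M → Ψ) (b : ℝ), 0 < b →
      (fun T : ℕ => regret L G θ init T) =o[atTop] fun T : ℕ => (T : ℝ) ^ b)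
    {θ : Fin M → Ψ} {i j : Fin M} (hi : i ∉ optimalChannels D G θ)
    (hj : j ∈ optimalChannels D G θ) {c : ℝ} (hc0 : 0 ≤ c)
    (hc : c * (G.I (θ i) (θ j)).toReal < 1) :
    ∀ᶠ T : ℕ in atTop,
      c ≤ (∫ ω, (plays i T ω : ℝ) ∂(trajLaw L G θ init)) / Real.log T := by
  obtain ⟨β, hβ, s, hs, hjs⟩ := hj
  set I₀ := (G.I (θ i) (θ j)).toReal with hI₀
  have hij : G.mean (β s) (θ i) < G.mean (β s) (θ j) := by
    refine lt_of_le_of_ne (hjs i) fun heq => hi ⟨β, hβ, s, hs, fun k => ?_⟩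
    rw [heq]; exact hjs k
  -- Room for the perturbation of the divergence; `c + 1` replaces `c` in the denominator because `c
  -- = 0` is allowed.
  obtain ⟨ε, hε, hcε⟩ : ∃ ε > 0, c * (I₀ + ε) < 1 := by
    refine ⟨(1 - c * I₀) / (2 * (c + 1)), div_pos (by linarith) (by linarith), ?_⟩
    have h1 : c * ((1 - c * I₀) / (2 * (c + 1))) = (1 - c * I₀) / 2 * (c / (c + 1)) := by
      field_simp
    have h2 : c / (c + 1) ≤ 1 := (div_le_one (by linarith)).2 (by linarith)
    have h3 : (1 - c * I₀) / 2 * (c / (c + 1)) ≤ (1 - c * I₀) / 2 * 1 :=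
      mul_le_mul_of_nonneg_left h2 (by linarith)
    rw [mul_add, h1]
    linarith
  obtain ⟨δ, hδ, hcont⟩ := hA4 ε hε (β s) (θ i) (θ j) hij
  obtain ⟨ψ, hψ1, hψ2⟩ := hA2 (θ j) (β s) δ hδ
  have hIψ := hA3 (θ i) ψ ⟨β s, hij.trans hψ1⟩
  have hclose := (abs_lt.1 (hcont ψ hψ1 hψ2)).1
  set θ' := Function.update θ i ψ with hθ'
  have hθ'i : θ' i = ψ := Function.update_self _ _ _
  have hθ'k : ∀ k, k ≠ i → θ' k = θ k := fun k hk => Function.update_of_ne hk _ _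
  have hcI : c * (G.I (θ i) (θ' i)).toReal < 1 := by
    rw [hθ'i]
    refine lt_of_le_of_lt (mul_le_mul_of_nonneg_left ?_ hc0) hcε
    linarith
  -- With this `b`, `c * I = 1 - 2 * b < 1 - b`, the strict inequality needed for the exponent `d =
  -- 1 - b`; also `b ≤ 1 / 2`, so `d` is positive.
  set b := (1 - c * (G.I (θ i) (θ' i)).toReal) / 2 with hb
  have hb0 : 0 < b := by linarith
  have hcI0 : 0 ≤ c * (G.I (θ i) (θ' i)).toReal := mul_nonneg hc0 ENNReal.toReal_nonneg
  -- Here `θ'` is the true vector. The vector with channel `i` a copy of `j` models the absence of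
  -- `i`, and the benchmark under `θ` separates the two.
  obtain ⟨η, C, hη, hC, hprob⟩ := exists_measure_plays_lt_le_rpow L G init hD hA1 (i := i)
    (θ := θ') (θ' := Function.update θ i (θ j))
    (fun k hk => by rw [Function.update_of_ne hk, hθ'k k hk])
    ((optReward_update_le G D θ i j).trans_lt (optReward_lt_update G D hD hi hβ hjs hψ1))
    hb0 (hL θ' b hb0)
  refine eventually_le_div_log (d := 1 - b) (C := Real.log (1 + C))
    (ENNReal.toReal_nonneg (a := G.I (θ i) (θ' i))) hη (by linarith) (by linarith) ?_
  filter_upwards [hprob, eventually_gt_atTop 0] with T h1 hT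
  refine le_trans (mul_le_mul_of_nonneg_left
    (one_sub_le_measure_plays_lt L G init θ i hη hT)
    (mul_nonneg (by linarith) (Real.log_natCast_nonneg T)))
    (log_mul_measure_le L G init hθ'k ?_ hT h1)
  rw [hθ'i]; exact hIψ.2.ne

end Consistency

end

end MultiChannel

theorem mainTheorem6 {S A Ψ 𝒳 : Type*}
    [Fintype S] [DecidableEq S] [MeasurableSpace S] [MeasurableSingletonClass S]
    [Fintype A] [MeasurableSpace A] [MeasurableSingletonClass A]
    [MeasurableSpace 𝒳] {M : ℕ}
    (D : MultiChannel.MDP S A) (hD : D.IsErgodic)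
    (G : MultiChannel.GainModel Ψ A 𝒳)
    (hA1 : G.A1) (hA2 : G.A2) (hA3 : G.A3) (hA4 : G.A4)
    (init : Measure S) [IsProbabilityMeasure init]
    (L : MultiChannel.AllocationRule D 𝒳 M)
    (hL : ∀ (θ : Fin M → Ψ) (b : ℝ), 0 < b →
      (fun T : ℕ => MultiChannel.regret L G θ init T) =o[atTop] fun T : ℕ => (T : ℝ) ^ b)
    (θ : Fin M → Ψ) :
    (MultiChannel.optimalChannels D G θ).Nonempty ∧
    ∀ i : Fin M, i ∉ MultiChannel.optimalChannels D G θ →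
      (⨆ j ∈ MultiChannel.optimalChannels D G θ, (G.I (θ i) (θ j))⁻¹) ≤
        liminf (fun T : ℕ => ENNReal.ofReal
          (∫ ω, (MultiChannel.plays i T ω : ℝ) / Real.log T
            ∂(MultiChannel.trajLaw L G θ init))) atTop := by
  have hS : Nonempty S := nonempty_of_isProbabilityMeasure init
  -- A rule is a probability kernel into `A × Fin M`, so its existence already provides a channel.
  have hM : Nonempty (Fin M) :=
    (nonempty_of_isProbabilityMeasure (L.choose 0 (Fin.elim0, hS.some))).map Prod.snd
  refine ⟨MultiChannel.optimalChannels_nonempty G D hD θ, fun i hi => iSup₂_le fun j hj => ?_⟩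
  refine le_of_forall_lt_imp_le_of_dense fun y hy => ?_
  have hytop : y ≠ ∞ := (hy.trans_le le_top).ne
  -- An infinite divergence has inverse zero, and nothing lies strictly below it.
  have hI : G.I (θ i) (θ j) ≠ ∞ := fun h => by simp [h] at hy
  have hy' : y * G.I (θ i) (θ j) < 1 := by
    rcases eq_or_ne (G.I (θ i) (θ j)) 0 with h0 | h0
    · simp [h0]
    · exact (ENNReal.lt_div_iff_mul_lt (Or.inl h0) (Or.inl hI)).1 (by rwa [one_div])
  have hc : y.toReal * (G.I (θ i) (θ j)).toReal < 1 := by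
    rw [← ENNReal.toReal_mul]
    exact (ENNReal.toReal_lt_toReal (ENNReal.mul_ne_top hytop hI) ENNReal.one_ne_top).2 hy'
  refine le_liminf_of_le (by isBoundedDefault) ?_
  filter_upwards [MultiChannel.eventually_le_integral_plays_div_log L G init hD hA1 hA2 hA3 hA4
    hL hi hj ENNReal.toReal_nonneg hc] with T hT
  rw [integral_div, ← ENNReal.ofReal_toReal hytop]
  exact ENNReal.ofReal_le_ofReal hT
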